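/- Let $(\mathcal C,\otimes,I,C)$ be an additive braided tensor category: a braided monoidal category with braiding $C$ that is additive and whose tensor product is additive in each variable. Associativity and unit constraints are suppressed. Write $C_{12}=C_{L,L}\otimes \mathrm{id}_L$, $C_{23}=\mathrm{id}_L\otimes C_{L,L}$ on $L\otimes L\otimes L$. All products of morphisms below are compositions, the rightmost applied first. **Definitions.** Let $L$ be an object on which $C$ is symmetric, i.e. $C_{L,L}C_{L,L}=\mathrm{id}_{L\otimes L}$. - $(L,[\,,])$ with $[\,,]:L\otimes L\to L$ is a *braided Lie algebra* if $[\,,](\mathrm{id}+C_{L,L})=0$ and $[\,,]([\,,]\otimes\mathrm{id})(\mathrm{id}+C_{12}C_{23}+C_{23}C_{12})=0$. - $(L,\delta)$ with $\delta:L\to L\otimes L$ is a *braided Lie coalgebra* if $(\mathrm{id}+C_{L,L})\delta=0$ and $(\mathrm{id}+C_{12}C_{23}+C_{23}C_{12})(\delta\otimes\mathrm{id})\delta=0$. - Put $\mathrm{ad}^{(2)}=[\,,]\otimes\mathrm{id}+(\mathrm{id}\otimes[\,,])(C_{L,L}\otimes\mathrm{id}):L\otimes L\otimes L\to L\otimes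 L$. $(L,[\,,],\delta)$ is a *braided Lie bialgebra* if it is a braided Lie algebra and a braided Lie coalgebra and $\delta[\,,]=\mathrm{ad}^{(2)}(\mathrm{id}\otimes\delta)(\mathrm{id}-C_{L,L})$. - For $R:I\to L\otimes L$, the pair $(L,R)$ is a *quasitriangular braided Lie bialgebra* if $L$ is a braided Lie bialgebra, $\delta=\mathrm{ad}^{(2)}(\mathrm{id}_L\otimes R)$, and $$\big([\,,]\otimes\mathrm{id}\otimes\mathrm{id}\big)C_{23}(R\otimes R)+\big(\mathrm{id}\otimes[\,,]\otimes\mathrm{id}\big)(R\otimes R)+\big(\mathrm{id}\otimes\mathrm{id}\otimes[\,,]\big)C_{23}(R\otimes R)=0,$$ where here $C_{23}=\mathrm{id}_L\otimes C_{L,L}\otimes\mathrm{id}_L$ (the classical Yang–Baxter equation). - Let $A,H$ be objects with brackets $[\,,]_A,[\,,]_H$ and cobrackets $\delta_A,\delta_H$, and let $\alpha:H\otimes A\to A$, $\beta:H\otimes A\to H$. The *double cross sum* $A\bowtie H$ is the object $A\oplus H$ with the bracket whose restrictions are $[\,,]_A$ on $A\otimes A$, $[\,,]_H$ on $H\otimes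 H$, $\alpha\oplus\beta$ on $H\otimes A$ and $-(\alpha\oplus\beta)C_{A,H}$ on $A\otimes H$, and with the cobracket $\delta_A$ on $A$ and $\delta_H$ on $H$. Let $(H,[\,,],\delta)$ be a braided Lie bialgebra in $\mathcal C$ (with $C$ symmetric on $H$) with a left dual $H^*$, with evaluation $\mathrm{ev}:H^*\otimes H\to I$ and coevaluation $\mathrm{coev}:I\to H\otimes H^*$. Equip $H^*$ with $$[\,,]_{H^*}=(\mathrm{ev}\otimes\mathrm{ev}\otimes\mathrm{id})(\mathrm{id}\otimes C_{H^*,H}\otimes\mathrm{id}\otimes\mathrm{id})(\mathrm{id}\otimes\mathrm{id}\otimes\delta\otimes\mathrm{id})(\mathrm{id}\otimes\mathrm{id}\otimes\mathrm{coev}),$$ $$\delta_{H^*}=(\mathrm{ev}\otimes\mathrm{id}\otimes\mathrm{id})(\mathrm{id}\otimes[\,,]\otimes\mathrm{id}\otimes\mathrm{id})(\mathrm{id}\otimes\mathrm{id}\otimes C_{H^*,H}\otimes\mathrm{id})(\mathrm{id}\otimes\mathrm{coev}\otimes\mathrm{coev}).$$ Let $H^{*\mathrm{op}}$ be $H^*$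 with bracket $-[\,,]_{H^*}$ and cobracket $\delta_{H^*}$, and $H^{*\mathrm{cop}}$ be $H^*$ with bracket $[\,,]_{H^*}$ and cobracket $-\delta_{H^*}$. **Theorem.** (i) Let $A=H^{*\mathrm{op}}$, $$\beta=(\mathrm{id}\otimes\mathrm{ev})(\mathrm{id}\otimes C_{H,H^*})(\delta\otimes\mathrm{id}),\qquad \alpha=(\mathrm{id}\otimes\mathrm{ev})(\mathrm{id}\otimes C_{H,H^*})(C_{H,H^*}\otimes\mathrm{id})(\mathrm{id}\otimes\delta_A),$$ and $R=C_{H,H^*}\,\mathrm{coev}:I\to A\otimes H\subset(A\bowtie H)\otimes(A\bowtie H)$. Then $(A\bowtie H,R)$ is a quasitriangular braided Lie bialgebra. (ii) Let $A=H^{*\mathrm{cop}}$, $$\beta=(\mathrm{ev}\otimes\mathrm{id})(C_{H,H^*}\otimes\mathrm{id})(\mathrm{id}\otimes C_{H,H^*})(\delta\otimes\mathrm{id}),\qquad \alpha=(\mathrm{ev}\otimes\mathrm{id})(C_{H,H^*}\otimes\mathrm{id})(\mathrm{id}\otimes\delta_A),$$ and $R=\mathrm{coev}:I\to H\otimes A\subset(A\bowtie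 H)\otimes(A\bowtie H)$. Then $(A\bowtie H,R)$ is a quasitriangular braided Lie bialgebra; $D(H)=H^{*\mathrm{cop}}\bowtie H$ is called the quantum double of $H$. -/

import Mathlib

open CategoryTheory MonoidalCategory Limits

universe v u

namespace BraidedLie

section Basic

variable {C : Type u} [Category.{v} C] [Preadditive C] [MonoidalCategory C] [BraidedCategory C]

/-- The morphism `C₁₂ = C_{L,L} ⊗ id` on `L ⊗ L ⊗ L`. -/
def braid12 (L : C) : (L ⊗ L) ⊗ L ⟶ (L ⊗ L) ⊗ L :=
  (β_ L L).hom ▷ L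

/-- The morphism `C₂₃ = id ⊗ C_{L,L}` on `L ⊗ L ⊗ L`. -/
def braid23 (L : C) : (L ⊗ L) ⊗ L ⟶ (L ⊗ L) ⊗ L :=
  (α_ L L L).hom ≫ L ◁ (β_ L L).hom ≫ (α_ L L L).inv

/-- The braiding is symmetric on the object `L`. -/
def IsSymmetricOn (L : C) : Prop :=
  (β_ L L).hom ≫ (β_ L L).hom = 𝟙 (L ⊗ L)

/-- Braided Lie algebras, on an object on which the braiding is symmetric. -/
structure IsBraidedLieAlgebra (L : C) (br : L ⊗ L ⟶ L) : Prop where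
  symm : IsSymmetricOn L
  antisymm : (𝟙 (L ⊗ L) + (β_ L L).hom) ≫ br = 0
  jacobi : (𝟙 ((L ⊗ L) ⊗ L) + braid23 L ≫ braid12 L + braid12 L ≫ braid23 L) ≫
    br ▷ L ≫ br = 0

/-- Braided Lie coalgebras, on an object on which the braiding is symmetric. -/
structure IsBraidedLieCoalgebra (L : C) (cobr : L ⟶ L ⊗ L) : Prop where
  symm : IsSymmetricOn L
  coantisymm : cobr ≫ (𝟙 (L ⊗ L) + (β_ L L).hom) = 0
  cojacobi : cobr ≫ cobr ▷ L ≫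
    (𝟙 ((L ⊗ L) ⊗ L) + braid23 L ≫ braid12 L + braid12 L ≫ braid23 L) = 0

/-- The adjoint action of `L` on `L ⊗ L`,
`x ⊗ (y ⊗ z) ↦ [x, y] ⊗ z + (id ⊗ [ , ]) (C (x ⊗ y) ⊗ z)`. -/
def adTensor (L : C) (br : L ⊗ L ⟶ L) : L ⊗ (L ⊗ L) ⟶ L ⊗ L :=
  (α_ L L L).inv ≫ br ▷ L +
    (α_ L L L).inv ≫ (β_ L L).hom ▷ L ≫ (α_ L L L).hom ≫ L ◁ br

/-- Braided Lie bialgebras. -/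
structure IsBraidedLieBialgebra (L : C) (br : L ⊗ L ⟶ L) (cobr : L ⟶ L ⊗ L) : Prop where
  lieAlgebra : IsBraidedLieAlgebra L br
  lieCoalgebra : IsBraidedLieCoalgebra L cobr
  compat : br ≫ cobr = (𝟙 (L ⊗ L) - (β_ L L).hom) ≫ L ◁ cobr ≫ adTensor L br

/-- The coboundary condition `δ (x) = [x, R¹] ⊗ R² + (id ⊗ [ , ]) (C (x ⊗ R¹) ⊗ R²)`. -/
def IsCoboundary (L : C) (br : L ⊗ L ⟶ L) (cobr : L ⟶ L ⊗ L) (R : 𝟙_ C ⟶ L ⊗ L) : Prop :=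
  cobr = (ρ_ L).inv ≫ L ◁ R ≫ adTensor L br

/-- The classical Yang-Baxter equation `[R₁₂, R₁₃] + [R₁₂, R₂₃] + [R₁₃, R₂₃] = 0`. -/
def IsCYBE (L : C) (br : L ⊗ L ⟶ L) (R : 𝟙_ C ⟶ L ⊗ L) : Prop :=
  ((λ_ (𝟙_ C)).inv ≫ (R ⊗ₘ R) ⊗≫ L ◁ ((β_ L L).hom ▷ L) ⊗≫ br ▷ (L ⊗ L)) +
  ((λ_ (𝟙_ C)).inv ≫ (R ⊗ₘ R) ⊗≫ L ◁ (br ▷ L)) +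
  ((λ_ (𝟙_ C)).inv ≫ (R ⊗ₘ R) ⊗≫ L ◁ ((β_ L L).hom ▷ L) ⊗≫ L ◁ (L ◁ br)) =
    (0 : 𝟙_ C ⟶ L ⊗ (L ⊗ L))

/-- Quasitriangular braided Lie bialgebras. -/
structure IsQuasitriangular (L : C) (br : L ⊗ L ⟶ L) (cobr : L ⟶ L ⊗ L)
    (R : 𝟙_ C ⟶ L ⊗ L) : Prop where
  lieBialgebra : IsBraidedLieBialgebra L br cobr
  coboundary : IsCoboundary L br cobr R
  cybe : IsCYBE L br R

end Basic

section Double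

variable {C : Type u} [Category.{v} C] [Preadditive C] [MonoidalCategory C] [BraidedCategory C]
  [HasBinaryBiproducts C]

/-- The bracket of the double bicrosssum on `A ⊞ H`, for `lact : H ⊗ A ⟶ A` and
`ract : H ⊗ A ⟶ H`. -/
noncomputable def doubleBracket (A H : C) (brA : A ⊗ A ⟶ A) (brH : H ⊗ H ⟶ H)
    (lact : H ⊗ A ⟶ A) (ract : H ⊗ A ⟶ H) : (A ⊞ H) ⊗ (A ⊞ H) ⟶ A ⊞ H :=
  ((biprod.fst ⊗ₘ biprod.fst) ≫ brA + (biprod.snd ⊗ₘ biprod.fst) ≫ lact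
      - (biprod.fst ⊗ₘ biprod.snd) ≫ (β_ A H).hom ≫ lact) ≫ biprod.inl +
  ((biprod.snd ⊗ₘ biprod.snd) ≫ brH + (biprod.snd ⊗ₘ biprod.fst) ≫ ract
      - (biprod.fst ⊗ₘ biprod.snd) ≫ (β_ A H).hom ≫ ract) ≫ biprod.inr

/-- The cobracket of the double bicrosssum on `A ⊞ H`, for `lcoact : A ⟶ H ⊗ A` and
`rcoact : H ⟶ H ⊗ A`. -/
noncomputable def doubleCobracket (A H : C) (cobrA : A ⟶ A ⊗ A) (cobrH : H ⟶ H ⊗ H)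
    (lcoact : A ⟶ H ⊗ A) (rcoact : H ⟶ H ⊗ A) : A ⊞ H ⟶ (A ⊞ H) ⊗ (A ⊞ H) :=
  biprod.fst ≫ (cobrA ≫ (biprod.inl ⊗ₘ biprod.inl) + lcoact ≫ (biprod.inr ⊗ₘ biprod.inl)
      - lcoact ≫ (β_ H A).hom ≫ (biprod.inl ⊗ₘ biprod.inr)) +
  biprod.snd ≫ (cobrH ≫ (biprod.inr ⊗ₘ biprod.inr) + rcoact ≫ (biprod.inr ⊗ₘ biprod.inl)
      - rcoact ≫ (β_ H A).hom ≫ (biprod.inl ⊗ₘ biprod.inr))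

end Double

section Dual

variable {C : Type u} [Category.{v} C] [MonoidalCategory C] [BraidedCategory C]
  (H Hd : C) [ExactPairing H Hd]

/-- Evaluation `H* ⊗ H ⟶ I`, where `Hd` is the left dual `H*` of `H`. -/
abbrev ev : Hd ⊗ H ⟶ 𝟙_ C := ExactPairing.evaluation H Hd

/-- Coevaluation `I ⟶ H ⊗ H*`. -/
abbrev coev : 𝟙_ C ⟶ H ⊗ Hd := ExactPairing.coevaluation H Hd

/-- The bracket of `H*`: `[f, g] = ∑ f (e_{i(1)}) g (e_{i(2)}) eⁱ`. -/
def dualBracket (cobr : H ⟶ H ⊗ H) : Hd ⊗ Hd ⟶ Hd :=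
  (ρ_ (Hd ⊗ Hd)).inv ≫
    (Hd ⊗ Hd) ◁ coev H Hd ≫
    (Hd ⊗ Hd) ◁ (cobr ▷ Hd) ⊗≫
    Hd ◁ ((β_ Hd H).hom ▷ (H ⊗ Hd)) ⊗≫
    (ev H Hd ⊗ₘ ev H Hd) ▷ Hd ⊗≫ 𝟙 Hd

/-- The cobracket of `H*`: `δ (f) = ∑ f ([e_i, e_j]) eⁱ ⊗ eʲ`. -/
def dualCobracket (br : H ⊗ H ⟶ H) : Hd ⟶ Hd ⊗ Hd :=
  𝟙 Hd ⊗≫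
    Hd ◁ (coev H Hd ⊗ₘ coev H Hd) ⊗≫
    Hd ◁ (H ◁ ((β_ Hd H).hom ▷ Hd)) ⊗≫
    Hd ◁ (br ▷ (Hd ⊗ Hd)) ⊗≫
    ev H Hd ▷ (Hd ⊗ Hd) ⊗≫ 𝟙 (Hd ⊗ Hd)

/-- The right action `x ⊗ f ↦ x₁ f (x₂)` of `H*ᵒᵖ` on `H`. -/
def opRightAct (cobr : H ⟶ H ⊗ H) : H ⊗ Hd ⟶ H :=
  cobr ▷ Hd ⊗≫ H ◁ (β_ H Hd).hom ⊗≫ H ◁ ev H Hd ⊗≫ 𝟙 H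

/-- The left action `x ⊗ f ↦ f₁ f₂ (x)` of `H` on `A = H*ᵒᵖ`, where `cobrA` is the cobracket
of `A`. -/
def opLeftAct (cobrA : Hd ⟶ Hd ⊗ Hd) : H ⊗ Hd ⟶ Hd :=
  H ◁ cobrA ⊗≫ (β_ H Hd).hom ▷ Hd ⊗≫ Hd ◁ (β_ H Hd).hom ⊗≫ Hd ◁ ev H Hd ⊗≫ 𝟙 Hd

/-- The right action `x ⊗ f ↦ f (x₁) x₂` of `H*ᶜᵒᵖ` on `H`. -/
def copRightAct (cobr : H ⟶ H ⊗ H) : H ⊗ Hd ⟶ H :=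
  cobr ▷ Hd ⊗≫ H ◁ (β_ H Hd).hom ⊗≫ (β_ H Hd).hom ▷ H ⊗≫ ev H Hd ▷ H ⊗≫ 𝟙 H

/-- The left action `x ⊗ f ↦ f₁ (x) f₂` of `H` on `A = H*ᶜᵒᵖ`, where `cobrA` is the cobracket
of `A`. -/
def copLeftAct (cobrA : Hd ⟶ Hd ⊗ Hd) : H ⊗ Hd ⟶ Hd :=
  H ◁ cobrA ⊗≫ (β_ H Hd).hom ▷ Hd ⊗≫ ev H Hd ▷ Hd ⊗≫ 𝟙 Hd

end Dual

section QuantumDouble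

variable {C : Type u} [Category.{v} C] [Preadditive C] [MonoidalCategory C] [BraidedCategory C]
  [HasBinaryBiproducts C] (H Hd : C) [ExactPairing H Hd]
  (br : H ⊗ H ⟶ H) (cobr : H ⟶ H ⊗ H)

/-- The bracket of `H*ᵒᵖ ⋈ H`; `H*ᵒᵖ` has the bracket of `H*` with the opposite sign and the
cobracket of `H*`. -/
noncomputable def opDoubleBracket : (Hd ⊞ H) ⊗ (Hd ⊞ H) ⟶ Hd ⊞ H :=
  doubleBracket Hd H (-dualBracket H Hd cobr) br
    (opLeftAct H Hd (dualCobracket H Hd br)) (opRightAct H Hd cobr)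

/-- The cobracket of `H*ᵒᵖ ⋈ H`; both coactions are zero. -/
noncomputable def opDoubleCobracket : Hd ⊞ H ⟶ (Hd ⊞ H) ⊗ (Hd ⊞ H) :=
  doubleCobracket Hd H (dualCobracket H Hd br) cobr 0 0

/-- `R = C_{H,H*} coev_H`, viewed in `(H*ᵒᵖ ⋈ H) ⊗ (H*ᵒᵖ ⋈ H)`. -/
noncomputable def opDoubleR : 𝟙_ C ⟶ (Hd ⊞ H) ⊗ (Hd ⊞ H) :=
  coev H Hd ≫ (β_ H Hd).hom ≫ (biprod.inl ⊗ₘ biprod.inr)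

/-- The bracket of the quantum double `D(H) = H*ᶜᵒᵖ ⋈ H`; `H*ᶜᵒᵖ` has the bracket of `H*` and the
cobracket of `H*` with the opposite sign. -/
noncomputable def quantumDoubleBracket : (Hd ⊞ H) ⊗ (Hd ⊞ H) ⟶ Hd ⊞ H :=
  doubleBracket Hd H (dualBracket H Hd cobr) br
    (copLeftAct H Hd (-dualCobracket H Hd br)) (copRightAct H Hd cobr)

/-- The cobracket of the quantum double `D(H) = H*ᶜᵒᵖ ⋈ H`; both coactions are zero. -/
noncomputable def quantumDoubleCobracket : Hd ⊞ H ⟶ (Hd ⊞ H) ⊗ (Hd ⊞ H) :=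
  doubleCobracket Hd H (-dualCobracket H Hd br) cobr 0 0

/-- `R = coev_H`, viewed in `D(H) ⊗ D(H)`. -/
noncomputable def quantumDoubleR : 𝟙_ C ⟶ (Hd ⊞ H) ⊗ (Hd ⊞ H) :=
  coev H Hd ≫ (biprod.inr ⊗ₘ biprod.inl)

end QuantumDouble

end BraidedLie

/-! This is the Manin triple argument, made to work in a braided category. On `Hd ⊞ H` there is the
symmetric form B(f + x, g + y) = f(y) + g(x), which is nondegenerate. The actions `opLeftAct` and
`opRightAct` are exactly the mixed brackets that make B invariant (`doubleForm_invariant`). Pairing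
with B then turns each identity for part (i) into a scalar identity. Jacobi becomes a statement
about B([X,Y],[Z,W]), whose components are the Jacobi identities of H and H*, and the compatibility
of bracket and cobracket of H (`dualBracket_bracket_ev`). The element R represents the half g(x) of
the form (`hR`), so invariance gives δ = ad(R). The bialgebra compatibility follows because ad is a
Lie action (`IsCoboundary.compat`). For a coboundary, two of the Yang-Baxter terms sum to (id ⊗ δ)R;
the third is the negative of this, because the bracket of H* is the transpose of δ
(`coev_dualBracket`).

Part (ii) is part (i) for the cobracket -δ, followed by replacing R with its flip and negating the
cobracket of the double (`IsQuasitriangular.flip`).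

To compute with elements, one uses morphisms K ⟶ X from a cocommutative comonoid K. They multiply by
means of the comultiplication, the braiding exchanges factors, and the scalars K ⟶ I form a
commutative ring. Maps out of a tensor product are detected by such elements (`tensor_hom_ext₂` and
its analogues), provided the braiding is symmetric on the factors. The category itself need not be
symmetric: symmetry on H extends to all pairs built from H and H*. -/

namespace BraidedLie

open scoped ComonObj

set_option linter.unusedSectionVars false

/-! ### Symmetry of the braiding on pairs of objects, and its extension to tensor products and
duals. -/

section SymPair

variable {C : Type u} [Category.{v} C] [MonoidalCategory C] [BraidedCategory C]

/-- The braiding is symmetric on the pair of objects `X`, `Y`. -/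
class SymPair (X Y : C) : Prop where
  braiding_braiding : (β_ X Y).hom ≫ (β_ Y X).hom = 𝟙 (X ⊗ Y)

theorem SymPair.braiding_braiding_assoc (X Y : C) [SymPair X Y] {T : C} (h : X ⊗ Y ⟶ T) :
    (β_ X Y).hom ≫ (β_ Y X).hom ≫ h = h := by
  rw [← Category.assoc, SymPair.braiding_braiding, Category.id_comp]

theorem SymPair.braiding_eq_inv (X Y : C) [SymPair X Y] : (β_ Y X).hom = (β_ X Y).inv := by
  rw [← cancel_epi (β_ X Y).hom, SymPair.braiding_braiding, Iso.hom_inv_id]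

theorem SymPair.swap (X Y : C) [SymPair X Y] : SymPair Y X where
  braiding_braiding := by rw [braiding_eq_inv X Y, Iso.inv_hom_id]

instance SymPair.unit_left (X : C) : SymPair (𝟙_ C) X where
  braiding_braiding := by simp [braiding_tensorUnit_left, braiding_tensorUnit_right]

instance SymPair.unit_right (X : C) : SymPair X (𝟙_ C) where
  braiding_braiding := by simp [braiding_tensorUnit_left, braiding_tensorUnit_right]

instance SymPair.tensor_left (X Y Z : C) [SymPair X Z] [SymPair Y Z] : SymPair (X ⊗ Y) Z where
  braiding_braiding := by
    rw [BraidedCategory.braiding_tensor_left_hom, BraidedCategory.braiding_tensor_right_hom,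
      braiding_eq_inv X Z, braiding_eq_inv Y Z]
    simp

instance SymPair.tensor_right (X Y Z : C) [SymPair X Y] [SymPair X Z] : SymPair X (Y ⊗ Z) where
  braiding_braiding := by
    rw [BraidedCategory.braiding_tensor_left_hom, BraidedCategory.braiding_tensor_right_hom,
      braiding_eq_inv X Y, braiding_eq_inv X Z]
    simp

/-- Moving `X` past the coevaluation over or under gives the same map, since both braidings with the
unit agree. The hexagon splits this into a part for `H`, which cancels by symmetry, and a part for
`Hd`; rigidity recovers the latter from its composite with coevaluation. -/
theorem SymPair.dual_left (X H Hd : C) [ExactPairing H Hd] [SymPair X H] : SymPair Hd X where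
  braiding_braiding := by
    have h1 : (η_ H Hd) ▷ X ≫ (β_ (H ⊗ Hd) X).hom = (η_ H Hd) ▷ X ≫ (β_ X (H ⊗ Hd)).inv := by
      rw [BraidedCategory.braiding_naturality_left, BraidedCategory.braiding_inv_naturality_left,
        SymPair.braiding_eq_inv X (𝟙_ C)]
    rw [BraidedCategory.braiding_tensor_left_hom, BraidedCategory.braiding_tensor_right_inv,
      ← SymPair.braiding_eq_inv X H] at h1
    have h2 : (tensorLeftHomEquiv X H Hd _) (β_ Hd X).hom
        = (tensorLeftHomEquiv X H Hd _) (β_ X Hd).inv := by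
      simp only [tensorLeftHomEquiv, Equiv.coe_fn_mk]
      rw [← cancel_mono ((α_ H X Hd).inv), ← cancel_mono ((β_ H X).hom ▷ Hd),
        ← cancel_mono ((α_ X H Hd).hom)]
      simpa using h1
    rw [(tensorLeftHomEquiv X H Hd _).injective h2, Iso.inv_hom_id]

end SymPair

/-! ### Tensor products and braidings of biproducts, checked on components. -/

section Biprod

variable {C : Type u} [Category.{v} C] [Preadditive C] [MonoidalCategory C]
  [MonoidalPreadditive C] [HasBinaryBiproducts C]

theorem biprod_whiskerRight_hom_ext {X Y Z W : C} {f g : (X ⊞ Y) ⊗ Z ⟶ W}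
    (hl : biprod.inl ▷ Z ≫ f = biprod.inl ▷ Z ≫ g)
    (hr : biprod.inr ▷ Z ≫ f = biprod.inr ▷ Z ≫ g) : f = g := by
  rw [← Category.id_comp f, ← Category.id_comp g, ← id_whiskerRight, ← biprod.total,
    MonoidalPreadditive.add_whiskerRight]
  simp [hl, hr]

theorem biprod_whiskerLeft_hom_ext {X Y Z W : C} {f g : Z ⊗ (X ⊞ Y) ⟶ W}
    (hl : Z ◁ biprod.inl ≫ f = Z ◁ biprod.inl ≫ g)
    (hr : Z ◁ biprod.inr ≫ f = Z ◁ biprod.inr ≫ g) : f = g := by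
  rw [← Category.id_comp f, ← Category.id_comp g, ← whiskerLeft_id, ← biprod.total,
    MonoidalPreadditive.whiskerLeft_add]
  simp [hl, hr]

theorem whiskerLeft_biprod_hom_ext {X Y Z W : C} {f g : W ⟶ Z ⊗ (X ⊞ Y)}
    (hl : f ≫ Z ◁ biprod.fst = g ≫ Z ◁ biprod.fst)
    (hr : f ≫ Z ◁ biprod.snd = g ≫ Z ◁ biprod.snd) : f = g := by
  rw [← Category.comp_id f, ← Category.comp_id g, ← whiskerLeft_id, ← biprod.total,
    MonoidalPreadditive.whiskerLeft_add]
  simp [reassoc_of% hl, reassoc_of% hr]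

variable [BraidedCategory C]

instance SymPair.biprod_left (X Y Z : C) [SymPair X Z] [SymPair Y Z] : SymPair (X ⊞ Y) Z where
  braiding_braiding := by
    apply biprod_whiskerRight_hom_ext <;>
    simp [SymPair.braiding_braiding_assoc]

instance SymPair.biprod_right (X Y Z : C) [SymPair X Y] [SymPair X Z] : SymPair X (Y ⊞ Z) where
  braiding_braiding := by
    apply biprod_whiskerLeft_hom_ext <;>
    simp [SymPair.braiding_braiding_assoc]

end Biprod

/-! ### Cocommutativity of tensor products of comonoids. -/

section Comon

variable {C : Type u} [Category.{v} C] [MonoidalCategory C] [BraidedCategory C]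

/-- Swapping the two copies of `X ⊗ Y` crosses `X` and `Y` in both directions. Without symmetry on
this pair a full twist would remain. -/
instance isCommComonObj_tensor (X Y : C) [ComonObj X] [ComonObj Y] [IsCommComonObj X]
    [IsCommComonObj Y] [SymPair X Y] : IsCommComonObj (X ⊗ Y) where
  comul_comm := by
    have h : tensorμ X X Y Y ≫ (β_ (X ⊗ Y) (X ⊗ Y)).hom =
        ((β_ X X).hom ⊗ₘ (β_ Y Y).hom) ≫ tensorμ X X Y Y := by
      simp [tensorμ, SymPair.braiding_eq_inv X Y,
        MonoidalCategory.tensorHom_def]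
    simp only [Comon.tensorObj_comul, Category.assoc, h, tensorHom_comp_tensorHom_assoc,
      IsCommComonObj.comul_comm]

end Comon

/-! ### The comonoid I ⊕ V, a cocommutative comonoid having V as a retract. -/

section SquareZero

variable {C : Type u} [Category.{v} C] [Preadditive C] [MonoidalCategory C]
  [MonoidalPreadditive C] [HasBinaryBiproducts C]

/-- The square-zero cocommutative comonoid `I ⊕ V`, in which `V` is primitive. -/
noncomputable def SquareZero (V : C) : C := 𝟙_ C ⊞ V

namespace SquareZero

variable (V : C)

/-- The group-like element of `I ⊕ V`. -/
noncomputable def one : 𝟙_ C ⟶ SquareZero V := biprod.inl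
/-- The primitive elements of `I ⊕ V`. -/
noncomputable def prim : V ⟶ SquareZero V := biprod.inr
/-- The counit of `I ⊕ V`. -/
noncomputable def counit : SquareZero V ⟶ 𝟙_ C := biprod.fst
/-- The projection of `I ⊕ V` to `V`. -/
noncomputable def proj : SquareZero V ⟶ V := biprod.snd

@[simp] theorem one_counit : one V ≫ counit V = 𝟙 _ := biprod.inl_fst

@[simp] theorem one_counit_assoc {T : C} (h : _ ⟶ T) :
    one V ≫ counit V ≫ h = 𝟙 _ ≫ h := by
  simp only [← Category.assoc, one_counit]

@[simp] theorem one_proj : one V ≫ proj V = 0 := biprod.inl_snd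

@[simp] theorem one_proj_assoc {T : C} (h : _ ⟶ T) :
    one V ≫ proj V ≫ h = 0 ≫ h := by
  simp only [← Category.assoc, one_proj]

@[simp] theorem prim_counit : prim V ≫ counit V = 0 := biprod.inr_fst

@[simp] theorem prim_counit_assoc {T : C} (h : _ ⟶ T) :
    prim V ≫ counit V ≫ h = 0 ≫ h := by
  simp only [← Category.assoc, prim_counit]

@[simp] theorem prim_proj : prim V ≫ proj V = 𝟙 _ := biprod.inr_snd

@[simp] theorem prim_proj_assoc {T : C} (h : _ ⟶ T) :
    prim V ≫ proj V ≫ h = 𝟙 _ ≫ h := by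
  simp only [← Category.assoc, prim_proj]

variable {V} in
theorem hom_ext {W : C} {f g : SquareZero V ⟶ W} (h1 : one V ≫ f = one V ≫ g)
    (h2 : prim V ≫ f = prim V ≫ g) : f = g := biprod.hom_ext' _ _ h1 h2

/-- The comultiplication of `I ⊕ V`. -/
noncomputable def comul : SquareZero V ⟶ SquareZero V ⊗ SquareZero V :=
  counit V ≫ (λ_ (𝟙_ C)).inv ≫ (one V ⊗ₘ one V) +
    proj V ≫ ((λ_ V).inv ≫ (one V ⊗ₘ prim V) + (ρ_ V).inv ≫ (prim V ⊗ₘ one V))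

@[simp]
theorem one_comul : one V ≫ comul V = (λ_ (𝟙_ C)).inv ≫ (one V ⊗ₘ one V) := by
  simp [comul]

@[simp] theorem one_comul_assoc {T : C} (h : _ ⟶ T) :
    one V ≫ comul V ≫ h = ((λ_ (𝟙_ C)).inv ≫ (one V ⊗ₘ one V)) ≫ h := by
  simp only [← Category.assoc, one_comul]

@[simp]
theorem prim_comul : prim V ≫ comul V =
    (λ_ V).inv ≫ (one V ⊗ₘ prim V) + (ρ_ V).inv ≫ (prim V ⊗ₘ one V) := by
  simp [comul]

@[simp] theorem prim_comul_assoc {T : C} (h : _ ⟶ T) :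
    prim V ≫ comul V ≫ h =
      ((λ_ V).inv ≫ (one V ⊗ₘ prim V) + (ρ_ V).inv ≫ (prim V ⊗ₘ one V)) ≫ h := by
  simp only [← Category.assoc, prim_comul]

theorem comul_comp_counit_whiskerRight :
    comul V ≫ counit V ▷ SquareZero V = (λ_ (SquareZero V)).inv := by
  apply hom_ext
  · simp [MonoidalCategory.tensorHom_def', ← comp_whiskerRight]
  · simp [MonoidalCategory.tensorHom_def', ← comp_whiskerRight]

theorem comul_comp_counit_whiskerLeft :
    comul V ≫ SquareZero V ◁ counit V = (ρ_ (SquareZero V)).inv := by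
  apply hom_ext
  · simp [MonoidalCategory.tensorHom_def, ← MonoidalCategory.whiskerLeft_comp, unitors_inv_equal]
  · simp [MonoidalCategory.tensorHom_def, ← MonoidalCategory.whiskerLeft_comp]

theorem comul_coassoc :
    comul V ≫ SquareZero V ◁ comul V =
      comul V ≫ comul V ▷ SquareZero V ≫ (α_ _ _ _).hom := by
  have hl {X Y Z W A : C} (f : X ⟶ Y) (g : Z ⟶ W) (h : W ⟶ A) :
      f ⊗ₘ (g ≫ h) = X ◁ g ≫ (f ⊗ₘ h) := by simp [whiskerLeft_comp_tensorHom]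
  have hr {X Y Z W A : C} (f : X ⟶ Y) (g : Z ⟶ W) (h : W ⟶ A) :
      (g ≫ h) ⊗ₘ f = g ▷ X ≫ (h ⊗ₘ f) := by simp [whiskerRight_comp_tensorHom]
  apply hom_ext
  · simp only [one_comul_assoc, Category.assoc, tensorHom_comp_whiskerLeft,
      tensorHom_comp_whiskerRight_assoc, one_comul, hl, hr, associator_naturality]
    monoidal
  · simp only [prim_comul_assoc, Preadditive.add_comp, Category.assoc, tensorHom_comp_whiskerLeft,
      tensorHom_comp_whiskerRight_assoc, one_comul, prim_comul, hl, hr, associator_naturality,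
      MonoidalPreadditive.tensor_add, MonoidalPreadditive.add_tensor, Preadditive.comp_add]
    have e1 : (λ_ V).inv ≫ 𝟙_ C ◁ (λ_ V).inv = (λ_ V).inv ≫ (λ_ (𝟙_ C)).inv ▷ V ≫ (α_ _ _ _).hom := by
      monoidal
    have e2 : (λ_ V).inv ≫ 𝟙_ C ◁ (ρ_ V).inv = (ρ_ V).inv ≫ (λ_ V).inv ▷ 𝟙_ C ≫ (α_ _ _ _).hom := by
      monoidal
    have e3 : (ρ_ V).inv ≫ V ◁ (λ_ (𝟙_ C)).inv = (ρ_ V).inv ≫ (ρ_ V).inv ▷ 𝟙_ C ≫ (α_ _ _ _).hom := by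
      monoidal
    rw [reassoc_of% e1, reassoc_of% e2, reassoc_of% e3]
    abel

noncomputable instance : ComonObj (SquareZero V) where
  counit := counit V
  comul := comul V
  counit_comul := comul_comp_counit_whiskerRight V
  comul_counit := comul_comp_counit_whiskerLeft V
  comul_assoc := comul_coassoc V

variable [BraidedCategory C]

instance : IsCommComonObj (SquareZero V) where
  comul_comm := by
    apply hom_ext
    · change one V ≫ comul V ≫ _ = one V ≫ comul V
      simp [unitors_inv_equal]
    · change prim V ≫ comul V ≫ _ = prim V ≫ comul V
      simp [braiding_tensorUnit_left, braiding_tensorUnit_right, add_comm]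

end SquareZero

end SquareZero

section Neg

variable {C : Type u} [Category.{v} C] [MonoidalCategory C] [Preadditive C]
  [MonoidalPreadditive C] {X Y : C}

@[simp] theorem neg_whiskerRight (f : X ⟶ Y) (Z : C) : (-f) ▷ Z = -(f ▷ Z) := by
  rw [eq_neg_iff_add_eq_zero, ← MonoidalPreadditive.add_whiskerRight]; simp

@[simp] theorem whiskerLeft_neg (Z : C) (f : X ⟶ Y) : Z ◁ (-f) = -(Z ◁ f) := by
  rw [eq_neg_iff_add_eq_zero, ← MonoidalPreadditive.whiskerLeft_add]; simp

end Neg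

/-! ### Calculus of generalized elements over a cocommutative comonoid. -/

section Elements

variable {C : Type u} [Category.{v} C] [MonoidalCategory C]
  {K : C} [ComonObj K]

/-- The product `x ⊠ₚ y : K ⟶ X ⊗ Y` of two generalized elements `x : K ⟶ X` and `y : K ⟶ Y`
defined on a comonoid `K`. -/
def pr {X Y : C} (x : K ⟶ X) (y : K ⟶ Y) : K ⟶ X ⊗ Y := Δ[K] ≫ (x ⊗ₘ y)

infixr:81 " ⊠ₚ " => pr

variable {X Y Z W : C}

@[simp]
theorem pr_whiskerRight (x : K ⟶ X) (y : K ⟶ Y) (f : X ⟶ Z) :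
    (x ⊠ₚ y) ≫ f ▷ Y = (x ≫ f) ⊠ₚ y := by
  simp [pr, tensorHom_comp_whiskerRight]

@[simp] theorem pr_whiskerRight_assoc (x : K ⟶ X) (y : K ⟶ Y) (f : X ⟶ Z) {T : C} (h : _ ⟶ T) :
    (x ⊠ₚ y) ≫ f ▷ Y ≫ h = ((x ≫ f) ⊠ₚ y) ≫ h := by
  simp only [← Category.assoc, pr_whiskerRight]

@[simp]
theorem pr_whiskerLeft (x : K ⟶ X) (y : K ⟶ Y) (f : Y ⟶ Z) :
    (x ⊠ₚ y) ≫ X ◁ f = x ⊠ₚ (y ≫ f) := by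
  simp [pr, tensorHom_comp_whiskerLeft]

@[simp] theorem pr_whiskerLeft_assoc (x : K ⟶ X) (y : K ⟶ Y) (f : Y ⟶ Z) {T : C} (h : _ ⟶ T) :
    (x ⊠ₚ y) ≫ X ◁ f ≫ h = (x ⊠ₚ (y ≫ f)) ≫ h := by
  simp only [← Category.assoc, pr_whiskerLeft]

@[simp]
theorem pr_tensorHom (x : K ⟶ X) (y : K ⟶ Y) (f : X ⟶ Z) (g : Y ⟶ W) :
    (x ⊠ₚ y) ≫ (f ⊗ₘ g) = (x ≫ f) ⊠ₚ (y ≫ g) := by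
  simp [pr]

@[simp] theorem pr_tensorHom_assoc (x : K ⟶ X) (y : K ⟶ Y) (f : X ⟶ Z) (g : Y ⟶ W)
    {T : C} (h : _ ⟶ T) :
    (x ⊠ₚ y) ≫ (f ⊗ₘ g) ≫ h = ((x ≫ f) ⊠ₚ (y ≫ g)) ≫ h := by
  simp only [← Category.assoc, pr_tensorHom]

@[simp]
theorem pr_associator_hom (x : K ⟶ X) (y : K ⟶ Y) (z : K ⟶ Z) :
    ((x ⊠ₚ y) ⊠ₚ z) ≫ (α_ X Y Z).hom = x ⊠ₚ (y ⊠ₚ z) := by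
  have hl {X Y Z W A : C} (f : X ⟶ Y) (g : Z ⟶ W) (h : W ⟶ A) :
      f ⊗ₘ (g ≫ h) = X ◁ g ≫ (f ⊗ₘ h) := by simp [whiskerLeft_comp_tensorHom]
  have hr {X Y Z W A : C} (f : X ⟶ Y) (g : Z ⟶ W) (h : W ⟶ A) :
      (g ≫ h) ⊗ₘ f = g ▷ X ≫ (h ⊗ₘ f) := by simp [whiskerRight_comp_tensorHom]
  simp only [pr, hl, hr, Category.assoc, associator_naturality, ComonObj.comul_assoc_assoc]

@[simp] theorem pr_associator_hom_assoc (x : K ⟶ X) (y : K ⟶ Y) (z : K ⟶ Z) {T : C} (h : _ ⟶ T) :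
    ((x ⊠ₚ y) ⊠ₚ z) ≫ (α_ X Y Z).hom ≫ h = (x ⊠ₚ (y ⊠ₚ z)) ≫ h := by
  simp only [← Category.assoc, pr_associator_hom]

@[simp]
theorem pr_associator_inv (x : K ⟶ X) (y : K ⟶ Y) (z : K ⟶ Z) :
    (x ⊠ₚ (y ⊠ₚ z)) ≫ (α_ X Y Z).inv = (x ⊠ₚ y) ⊠ₚ z := by
  rw [← pr_associator_hom, Category.assoc, Iso.hom_inv_id, Category.comp_id]

@[simp] theorem pr_associator_inv_assoc (x : K ⟶ X) (y : K ⟶ Y) (z : K ⟶ Z) {T : C} (h : _ ⟶ T) :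
    (x ⊠ₚ (y ⊠ₚ z)) ≫ (α_ X Y Z).inv ≫ h = ((x ⊠ₚ y) ⊠ₚ z) ≫ h := by
  simp only [← Category.assoc, pr_associator_inv]

@[simp]
-- By naturality the braiding moves back to `K ⊗ K`, where cocommutativity absorbs it. No symmetry
-- on `X`, `Y` is needed here; it enters only when suitable comonoids are built.
theorem pr_braiding [BraidedCategory C] [IsCommComonObj K] (x : K ⟶ X) (y : K ⟶ Y) :
    (x ⊠ₚ y) ≫ (β_ X Y).hom = y ⊠ₚ x := by
  simp [pr, BraidedCategory.braiding_naturality, IsCommComonObj.comul_comm_assoc]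

@[simp] theorem pr_braiding_assoc [BraidedCategory C] [IsCommComonObj K] (x : K ⟶ X) (y : K ⟶ Y)
    {T : C} (h : _ ⟶ T) :
    (x ⊠ₚ y) ≫ (β_ X Y).hom ≫ h = (y ⊠ₚ x) ≫ h := by
  simp only [← Category.assoc, pr_braiding]

theorem counit_pr_leftUnitor (x : K ⟶ X) : (ε[K] ⊠ₚ x) ≫ (λ_ X).hom = x := by
  simp [pr]

theorem comp_leftUnitor_inv (x : K ⟶ X) : x ≫ (λ_ X).inv = ε[K] ⊠ₚ x := by
  rw [Iso.comp_inv_eq, counit_pr_leftUnitor]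

theorem comp_rightUnitor_inv (x : K ⟶ X) : x ≫ (ρ_ X).inv = x ⊠ₚ ε[K] := by
  simp [pr, ComonObj.comul_counit_hom]

section Additive

variable [Preadditive C] [MonoidalPreadditive C]

@[simp] theorem pr_add (x : K ⟶ X) (y z : K ⟶ Y) : x ⊠ₚ (y + z) = x ⊠ₚ y + x ⊠ₚ z := by
  simp [pr, MonoidalPreadditive.tensor_add]

@[simp] theorem add_pr (x y : K ⟶ X) (z : K ⟶ Y) : (x + y) ⊠ₚ z = x ⊠ₚ z + y ⊠ₚ z := by
  simp [pr, MonoidalPreadditive.add_tensor]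

@[simp] theorem pr_zero (x : K ⟶ X) : x ⊠ₚ (0 : K ⟶ Y) = 0 := by simp [pr]

@[simp] theorem zero_pr (x : K ⟶ X) : (0 : K ⟶ Y) ⊠ₚ x = 0 := by simp [pr]

@[simp] theorem pr_neg (x : K ⟶ X) (y : K ⟶ Y) : x ⊠ₚ (-y) = -(x ⊠ₚ y) := by
  rw [eq_neg_iff_add_eq_zero, ← pr_add]; simp

@[simp] theorem neg_pr (x : K ⟶ X) (y : K ⟶ Y) : (-x) ⊠ₚ y = -(x ⊠ₚ y) := by
  rw [eq_neg_iff_add_eq_zero, ← add_pr]; simp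

@[simp] theorem pr_sub (x : K ⟶ X) (y z : K ⟶ Y) : x ⊠ₚ (y - z) = x ⊠ₚ y - x ⊠ₚ z := by
  simp [sub_eq_add_neg]

@[simp] theorem sub_pr (x y : K ⟶ X) (z : K ⟶ Y) : (x - y) ⊠ₚ z = x ⊠ₚ z - y ⊠ₚ z := by
  simp [sub_eq_add_neg]

variable [BraidedCategory C] [IsCommComonObj K]

instance : SMul (K ⟶ 𝟙_ C) (K ⟶ X) where
  smul s x := (s ⊠ₚ x) ≫ (λ_ X).hom

theorem smul_def (s : K ⟶ 𝟙_ C) (x : K ⟶ X) : s • x = (s ⊠ₚ x) ≫ (λ_ X).hom := rfl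

instance : Mul (K ⟶ 𝟙_ C) where
  mul s t := s • t

instance : One (K ⟶ 𝟙_ C) where
  one := ε[K]

theorem smul_comp_hom (s : K ⟶ 𝟙_ C) (x : K ⟶ X) (f : X ⟶ Y) : (s • x) ≫ f = s • (x ≫ f) := by
  rw [smul_def, smul_def, Category.assoc, ← leftUnitor_naturality, pr_whiskerLeft_assoc]

theorem smul_smul_hom (s t : K ⟶ 𝟙_ C) (x : K ⟶ X) : (s • t) • x = s • t • x := by
  have : (s ⊠ₚ (t ⊠ₚ x)) ≫ (α_ _ _ _).inv ≫ (λ_ (𝟙_ C)).hom ▷ X =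
    (s ⊠ₚ (t ⊠ₚ x)) ≫ _ ◁ (λ_ X).hom := by congr 1; monoidal
  rw [pr_associator_inv_assoc, pr_whiskerRight, pr_whiskerLeft] at this
  exact congr_arg (· ≫ (λ_ X).hom) this

theorem smul_hom_comm (s t : K ⟶ 𝟙_ C) : s • t = t • s := by
  rw [smul_def, ← pr_braiding, Category.assoc, braiding_leftUnitor, ← unitors_equal, smul_def]

/-- This is the convolution ring, with the counit as unit. It makes `ring` and `linear_combination`
available for identities between evaluated pairings. -/
instance : CommRing (K ⟶ 𝟙_ C) where
  __ := (inferInstance : AddCommGroup (K ⟶ 𝟙_ C))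
  left_distrib a b c := by
    change (a ⊠ₚ (b + c)) ≫ (λ_ _).hom = (a ⊠ₚ b) ≫ (λ_ _).hom + (a ⊠ₚ c) ≫ (λ_ _).hom
    rw [pr_add, Preadditive.add_comp]
  right_distrib a b c := by
    change ((a + b) ⊠ₚ c) ≫ (λ_ _).hom = (a ⊠ₚ c) ≫ (λ_ _).hom + (b ⊠ₚ c) ≫ (λ_ _).hom
    rw [add_pr, Preadditive.add_comp]
  zero_mul a := by
    change (0 ⊠ₚ a) ≫ (λ_ _).hom = 0
    rw [zero_pr, zero_comp]
  mul_zero a := by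
    change (a ⊠ₚ 0) ≫ (λ_ _).hom = 0
    rw [pr_zero, zero_comp]
  mul_assoc a b c := smul_smul_hom a b c
  one_mul a := counit_pr_leftUnitor a
  mul_one a := (smul_hom_comm _ _).trans (counit_pr_leftUnitor a)
  mul_comm a b := smul_hom_comm a b

instance : Module (K ⟶ 𝟙_ C) (K ⟶ X) where
  one_smul := counit_pr_leftUnitor
  mul_smul := smul_smul_hom
  smul_zero s := by simp [smul_def]
  zero_smul s := by simp [smul_def]
  smul_add s x y := by simp [smul_def]
  add_smul s t x := by simp [smul_def]

@[simp]
theorem smul_comp_eq (s : K ⟶ 𝟙_ C) (x : K ⟶ X) (f : X ⟶ Y) : (s • x) ≫ f = s • (x ≫ f) :=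
  smul_comp_hom s x f

@[simp]
theorem pr_leftUnitor (s : K ⟶ 𝟙_ C) (x : K ⟶ X) : (s ⊠ₚ x) ≫ (λ_ X).hom = s • x := rfl

@[simp] theorem pr_leftUnitor_assoc (s : K ⟶ 𝟙_ C) (x : K ⟶ X) {T : C} (h : _ ⟶ T) :
    (s ⊠ₚ x) ≫ (λ_ X).hom ≫ h = (s • x) ≫ h := by
  simp only [← Category.assoc, pr_leftUnitor]

@[simp]
theorem pr_rightUnitor (s : K ⟶ 𝟙_ C) (x : K ⟶ X) : (x ⊠ₚ s) ≫ (ρ_ X).hom = s • x := by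
  rw [← pr_braiding, Category.assoc]
  simp [braiding_tensorUnit_left]

@[simp]
theorem comp_leftUnitor_inv_eq (x : K ⟶ X) : x ≫ (λ_ X).inv = (1 : K ⟶ 𝟙_ C) ⊠ₚ x :=
  comp_leftUnitor_inv x

@[simp] theorem comp_leftUnitor_inv_eq_assoc (x : K ⟶ X) {T : C} (h : _ ⟶ T) :
    x ≫ (λ_ X).inv ≫ h = ((1 : K ⟶ 𝟙_ C) ⊠ₚ x) ≫ h := by
  simp only [← Category.assoc, comp_leftUnitor_inv_eq]

@[simp]
theorem comp_rightUnitor_inv_eq (x : K ⟶ X) : x ≫ (ρ_ X).inv = x ⊠ₚ (1 : K ⟶ 𝟙_ C) :=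
  comp_rightUnitor_inv x

@[simp] theorem comp_rightUnitor_inv_eq_assoc (x : K ⟶ X) {T : C} (h : _ ⟶ T) :
    x ≫ (ρ_ X).inv ≫ h = (x ⊠ₚ (1 : K ⟶ 𝟙_ C)) ≫ h := by
  simp only [← Category.assoc, comp_rightUnitor_inv_eq]

@[simp]
theorem smul_pr (s : K ⟶ 𝟙_ C) (x : K ⟶ X) (y : K ⟶ Y) : (s • x) ⊠ₚ y = s • (x ⊠ₚ y) := by
  have : (s ⊠ₚ (x ⊠ₚ y)) ≫ (α_ _ _ _).inv ≫ (λ_ X).hom ▷ Y =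
    (s ⊠ₚ (x ⊠ₚ y)) ≫ (λ_ _).hom := by congr 1; monoidal
  rw [pr_associator_inv_assoc, pr_whiskerRight] at this
  exact this

@[simp]
theorem pr_smul (s : K ⟶ 𝟙_ C) (x : K ⟶ X) (y : K ⟶ Y) : x ⊠ₚ (s • y) = s • (x ⊠ₚ y) := by
  rw [← pr_braiding, smul_pr, smul_comp_eq, pr_braiding]

@[simp] theorem smul_scalar (s t : K ⟶ 𝟙_ C) : s • t = s * t := rfl

end Additive

end Elements

/-! ### Detecting morphisms out of tensor products by products of elements. -/

section Ext

variable {C : Type u} [Category.{v} C] [MonoidalCategory C] [BraidedCategory C]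

section
variable {K₁ K₂ : C} [ComonObj K₁] [ComonObj K₂] {X Y Z W : C}

/-- An element on the first factor, as an element on the tensor product. -/
def onFst (K₂ : C) [ComonObj K₂] (x : K₁ ⟶ X) : K₁ ⊗ K₂ ⟶ X := K₁ ◁ ε[K₂] ≫ (ρ_ K₁).hom ≫ x

/-- An element on the second factor, as an element on the tensor product. -/
def onSnd (K₁ : C) [ComonObj K₁] (y : K₂ ⟶ Y) : K₁ ⊗ K₂ ⟶ Y := ε[K₁] ▷ K₂ ≫ (λ_ K₂).hom ≫ y

/-- The counits delete the superfluous copies, so elements living on different factors behave as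
independent variables. -/
theorem onFst_pr_onSnd (x : K₁ ⟶ X) (y : K₂ ⟶ Y) :
    onFst K₂ x ⊠ₚ onSnd K₁ y = x ⊗ₘ y := by
  have h : tensorμ K₁ K₁ K₂ K₂ ≫ ((K₁ ◁ ε[K₂]) ⊗ₘ (ε[K₁] ▷ K₂)) =
      (K₁ ◁ ε[K₁] ⊗ₘ ε[K₂] ▷ K₂) ≫ tensorμ K₁ (𝟙_ C) (𝟙_ C) K₂ := by
    simpa using (tensorμ_natural (𝟙 K₁) ε[K₁] ε[K₂] (𝟙 K₂)).symm
  have h2 : ((ρ_ K₁).inv ⊗ₘ (λ_ K₂).inv) ≫ tensorμ K₁ (𝟙_ C) (𝟙_ C) K₂ ≫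
      ((ρ_ K₁).hom ⊗ₘ (λ_ K₂).hom) = 𝟙 _ := by
    simp only [tensorμ, braiding_tensorUnit_left]
    monoidal
  simp only [pr, onFst, onSnd, Comon.tensorObj_comul, Category.assoc]
  rw [← tensorHom_comp_tensorHom, reassoc_of% h, tensorHom_comp_tensorHom_assoc,
    ComonObj.comul_counit, ComonObj.counit_comul, ← tensorHom_comp_tensorHom, reassoc_of% h2]

theorem onSnd_pr (x : K₂ ⟶ X) (y : K₂ ⟶ Y) :
    onSnd K₁ (x ⊠ₚ y) = onSnd K₁ x ⊠ₚ onSnd K₁ y := by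
  have h : tensorμ K₁ K₁ K₂ K₂ ≫ ((ε[K₁] ▷ K₂) ⊗ₘ (ε[K₁] ▷ K₂)) =
      ((ε[K₁] ⊗ₘ ε[K₁]) ▷ (K₂ ⊗ K₂)) ≫ tensorμ (𝟙_ C) (𝟙_ C) K₂ K₂ :=
    (tensorμ_natural_left _ _ _ _).symm
  have h3 : Δ[K₁] ≫ (ε[K₁] ⊗ₘ ε[K₁]) = ε[K₁] ≫ (λ_ (𝟙_ C)).inv := by
    simp [MonoidalCategory.tensorHom_def]
  have h4 : onSnd K₁ (Δ[K₂]) = Δ[K₁ ⊗ K₂] ≫ (onSnd K₁ (𝟙 K₂) ⊗ₘ onSnd K₁ (𝟙 K₂)) := by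
    simp only [onSnd, Comon.tensorObj_comul, Category.assoc, Category.comp_id]
    rw [← tensorHom_comp_tensorHom, reassoc_of% h, MonoidalCategory.tensorHom_def', Category.assoc,
      ← comp_whiskerRight_assoc, h3, comp_whiskerRight_assoc, ← tensor_left_unitality,
      whisker_exchange_assoc, leftUnitor_naturality]
  have h5 {X : C} (f : K₂ ⟶ X) : onSnd K₁ f = onSnd K₁ (𝟙 K₂) ≫ f := by simp [onSnd]
  rw [h5, h5 x, h5 y, pr, pr, ← tensorHom_comp_tensorHom, ← reassoc_of% h4, h5 Δ, Category.assoc]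

end

variable [Preadditive C] [MonoidalPreadditive C] [HasBinaryBiproducts C]

instance (X Y : C) [SymPair X Y] : SymPair (SquareZero X) Y :=
  inferInstanceAs (SymPair (𝟙_ C ⊞ X) Y)

instance (X Y : C) [SymPair X Y] : SymPair X (SquareZero Y) :=
  inferInstanceAs (SymPair X (𝟙_ C ⊞ Y))

variable {X₁ X₂ X₃ X₄ X₅ X₆ X₇ Z : C}

local notation "pj" => SquareZero.proj

theorem hom_ext_elements {m m' : X₁ ⟶ Z}
    (h : ∀ (K : C) [ComonObj K] [IsCommComonObj K] (x₁ : K ⟶ X₁), x₁ ≫ m = x₁ ≫ m') : m = m' := by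
  rw [← Category.id_comp m, ← Category.id_comp m', ← SquareZero.prim_proj X₁, Category.assoc,
    Category.assoc, h]

/-- Here the unit element is the counit of `K`; for `K` = `SquareZero (𝟙_ C)` it is split by
`SquareZero.one`. -/
theorem unit_hom_ext_elements {m m' : 𝟙_ C ⟶ Z}
    (h : ∀ (K : C) [ComonObj K] [IsCommComonObj K], (1 : K ⟶ 𝟙_ C) ≫ m = (1 : K ⟶ 𝟙_ C) ≫ m') :
    m = m' := by
  have := SquareZero.one (𝟙_ C) ≫= h (SquareZero (𝟙_ C))
  have e : SquareZero.one (𝟙_ C) ≫ (1 : SquareZero (𝟙_ C) ⟶ 𝟙_ C) = 𝟙 _ :=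
    SquareZero.one_counit _
  simpa [reassoc_of% e] using this

/-- Test on the universal elements: take `K` to be the tensor product of the `SquareZero Xᵢ` and let
the i-th element be the projection of the i-th factor to `Xᵢ`. Their product is the tensor product
of the projections, which is split by the tensor product of the primitive inclusions. The pairwise
symmetry makes `K` cocommutative. The versions with more factors work in the same way. -/
theorem tensor_hom_ext₂ [SymPair X₁ X₂]
    {m m' : X₁ ⊗ X₂ ⟶ Z}
    (h : ∀ (K : C) [ComonObj K] [IsCommComonObj K]
      (x₁ : K ⟶ X₁) (x₂ : K ⟶ X₂),
      (x₁ ⊠ₚ x₂) ≫ m =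
        (x₁ ⊠ₚ x₂) ≫ m') : m = m' := by
  have :=
      (SquareZero.prim X₁ ⊗ₘ SquareZero.prim X₂) ≫=
    h (SquareZero X₁ ⊗ SquareZero X₂)
      (onFst _ (pj X₁))
      (onSnd _ (pj X₂))
  simpa only [← onSnd_pr, onFst_pr_onSnd, tensorHom_comp_tensorHom_assoc,
    tensorHom_comp_tensorHom, SquareZero.prim_proj, id_tensorHom_id, Category.id_comp] using this

theorem tensor_hom_ext₃ [SymPair X₁ X₂] [SymPair X₁ X₃] [SymPair X₂ X₃]
    {m m' : X₁ ⊗ (X₂ ⊗ X₃) ⟶ Z}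
    (h : ∀ (K : C) [ComonObj K] [IsCommComonObj K]
      (x₁ : K ⟶ X₁) (x₂ : K ⟶ X₂) (x₃ : K ⟶ X₃),
      (x₁ ⊠ₚ (x₂ ⊠ₚ x₃)) ≫ m =
        (x₁ ⊠ₚ (x₂ ⊠ₚ x₃)) ≫ m') : m = m' := by
  have :=
      (SquareZero.prim X₁ ⊗ₘ (SquareZero.prim X₂ ⊗ₘ SquareZero.prim X₃)) ≫=
    h (SquareZero X₁ ⊗ (SquareZero X₂ ⊗ SquareZero X₃))
      (onFst _ (pj X₁))
      (onSnd _ (onFst _ (pj X₂)))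
      (onSnd _ (onSnd _ (pj X₃)))
  simpa only [← onSnd_pr, onFst_pr_onSnd, tensorHom_comp_tensorHom_assoc,
    tensorHom_comp_tensorHom, SquareZero.prim_proj, id_tensorHom_id, Category.id_comp] using this

theorem tensor_hom_ext₄ [SymPair X₁ X₂] [SymPair X₁ X₃] [SymPair X₁ X₄] [SymPair X₂ X₃]
    [SymPair X₂ X₄] [SymPair X₃ X₄]
    {m m' : X₁ ⊗ (X₂ ⊗ (X₃ ⊗ X₄)) ⟶ Z}
    (h : ∀ (K : C) [ComonObj K] [IsCommComonObj K]
      (x₁ : K ⟶ X₁) (x₂ : K ⟶ X₂) (x₃ : K ⟶ X₃) (x₄ : K ⟶ X₄),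
      (x₁ ⊠ₚ (x₂ ⊠ₚ (x₃ ⊠ₚ x₄))) ≫ m =
        (x₁ ⊠ₚ (x₂ ⊠ₚ (x₃ ⊠ₚ x₄))) ≫ m') : m = m' := by
  have :=
      (SquareZero.prim X₁ ⊗ₘ (SquareZero.prim X₂ ⊗ₘ (SquareZero.prim X₃ ⊗ₘ SquareZero.prim X₄))) ≫=
    h (SquareZero X₁ ⊗ (SquareZero X₂ ⊗ (SquareZero X₃ ⊗ SquareZero X₄)))
      (onFst _ (pj X₁))
      (onSnd _ (onFst _ (pj X₂)))
      (onSnd _ (onSnd _ (onFst _ (pj X₃))))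
      (onSnd _ (onSnd _ (onSnd _ (pj X₄))))
  simpa only [← onSnd_pr, onFst_pr_onSnd, tensorHom_comp_tensorHom_assoc,
    tensorHom_comp_tensorHom, SquareZero.prim_proj, id_tensorHom_id, Category.id_comp] using this

theorem tensor_hom_ext₅ [SymPair X₁ X₂] [SymPair X₁ X₃] [SymPair X₁ X₄] [SymPair X₁ X₅]
    [SymPair X₂ X₃] [SymPair X₂ X₄] [SymPair X₂ X₅] [SymPair X₃ X₄] [SymPair X₃ X₅]
    [SymPair X₄ X₅]
    {m m' : X₁ ⊗ (X₂ ⊗ (X₃ ⊗ (X₄ ⊗ X₅))) ⟶ Z}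
    (h : ∀ (K : C) [ComonObj K] [IsCommComonObj K]
      (x₁ : K ⟶ X₁) (x₂ : K ⟶ X₂) (x₃ : K ⟶ X₃) (x₄ : K ⟶ X₄) (x₅ : K ⟶ X₅),
      (x₁ ⊠ₚ (x₂ ⊠ₚ (x₃ ⊠ₚ (x₄ ⊠ₚ x₅)))) ≫ m =
        (x₁ ⊠ₚ (x₂ ⊠ₚ (x₃ ⊠ₚ (x₄ ⊠ₚ x₅)))) ≫ m') : m = m' := by
  have :=
      (SquareZero.prim X₁ ⊗ₘ (SquareZero.prim X₂ ⊗ₘ (SquareZero.prim X₃ ⊗ₘ (SquareZero.prim X₄ ⊗ₘ SquareZero.prim X₅)))) ≫=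
    h (SquareZero X₁ ⊗ (SquareZero X₂ ⊗ (SquareZero X₃ ⊗ (SquareZero X₄ ⊗ SquareZero X₅))))
      (onFst _ (pj X₁))
      (onSnd _ (onFst _ (pj X₂)))
      (onSnd _ (onSnd _ (onFst _ (pj X₃))))
      (onSnd _ (onSnd _ (onSnd _ (onFst _ (pj X₄)))))
      (onSnd _ (onSnd _ (onSnd _ (onSnd _ (pj X₅)))))
  simpa only [← onSnd_pr, onFst_pr_onSnd, tensorHom_comp_tensorHom_assoc,
    tensorHom_comp_tensorHom, SquareZero.prim_proj, id_tensorHom_id, Category.id_comp] using this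

theorem tensor_hom_ext₆ [SymPair X₁ X₂] [SymPair X₁ X₃] [SymPair X₁ X₄] [SymPair X₁ X₅]
    [SymPair X₁ X₆] [SymPair X₂ X₃] [SymPair X₂ X₄] [SymPair X₂ X₅] [SymPair X₂ X₆]
    [SymPair X₃ X₄] [SymPair X₃ X₅] [SymPair X₃ X₆] [SymPair X₄ X₅] [SymPair X₄ X₆]
    [SymPair X₅ X₆]
    {m m' : X₁ ⊗ (X₂ ⊗ (X₃ ⊗ (X₄ ⊗ (X₅ ⊗ X₆)))) ⟶ Z}
    (h : ∀ (K : C) [ComonObj K] [IsCommComonObj K]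
      (x₁ : K ⟶ X₁) (x₂ : K ⟶ X₂) (x₃ : K ⟶ X₃) (x₄ : K ⟶ X₄) (x₅ : K ⟶ X₅) (x₆ : K ⟶ X₆),
      (x₁ ⊠ₚ (x₂ ⊠ₚ (x₃ ⊠ₚ (x₄ ⊠ₚ (x₅ ⊠ₚ x₆))))) ≫ m =
        (x₁ ⊠ₚ (x₂ ⊠ₚ (x₃ ⊠ₚ (x₄ ⊠ₚ (x₅ ⊠ₚ x₆))))) ≫ m') : m = m' := by
  have :=
      (SquareZero.prim X₁ ⊗ₘ (SquareZero.prim X₂ ⊗ₘ (SquareZero.prim X₃ ⊗ₘ (SquareZero.prim X₄ ⊗ₘ (SquareZero.prim X₅ ⊗ₘ SquareZero.prim X₆))))) ≫=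
    h (SquareZero X₁ ⊗ (SquareZero X₂ ⊗ (SquareZero X₃ ⊗ (SquareZero X₄ ⊗ (SquareZero X₅ ⊗ SquareZero X₆)))))
      (onFst _ (pj X₁))
      (onSnd _ (onFst _ (pj X₂)))
      (onSnd _ (onSnd _ (onFst _ (pj X₃))))
      (onSnd _ (onSnd _ (onSnd _ (onFst _ (pj X₄)))))
      (onSnd _ (onSnd _ (onSnd _ (onSnd _ (onFst _ (pj X₅))))))
      (onSnd _ (onSnd _ (onSnd _ (onSnd _ (onSnd _ (pj X₆))))))
  simpa only [← onSnd_pr, onFst_pr_onSnd, tensorHom_comp_tensorHom_assoc,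
    tensorHom_comp_tensorHom, SquareZero.prim_proj, id_tensorHom_id, Category.id_comp] using this

theorem tensor_hom_ext₇ [SymPair X₁ X₂] [SymPair X₁ X₃] [SymPair X₁ X₄] [SymPair X₁ X₅]
    [SymPair X₁ X₆] [SymPair X₁ X₇] [SymPair X₂ X₃] [SymPair X₂ X₄] [SymPair X₂ X₅]
    [SymPair X₂ X₆] [SymPair X₂ X₇] [SymPair X₃ X₄] [SymPair X₃ X₅] [SymPair X₃ X₆]
    [SymPair X₃ X₇] [SymPair X₄ X₅] [SymPair X₄ X₆] [SymPair X₄ X₇] [SymPair X₅ X₆]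
    [SymPair X₅ X₇] [SymPair X₆ X₇]
    {m m' : X₁ ⊗ (X₂ ⊗ (X₃ ⊗ (X₄ ⊗ (X₅ ⊗ (X₆ ⊗ X₇))))) ⟶ Z}
    (h : ∀ (K : C) [ComonObj K] [IsCommComonObj K]
      (x₁ : K ⟶ X₁) (x₂ : K ⟶ X₂) (x₃ : K ⟶ X₃) (x₄ : K ⟶ X₄) (x₅ : K ⟶ X₅) (x₆ : K ⟶ X₆) (x₇ : K ⟶ X₇),
      (x₁ ⊠ₚ (x₂ ⊠ₚ (x₃ ⊠ₚ (x₄ ⊠ₚ (x₅ ⊠ₚ (x₆ ⊠ₚ x₇)))))) ≫ m =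
        (x₁ ⊠ₚ (x₂ ⊠ₚ (x₃ ⊠ₚ (x₄ ⊠ₚ (x₅ ⊠ₚ (x₆ ⊠ₚ x₇)))))) ≫ m') : m = m' := by
  have :=
      (SquareZero.prim X₁ ⊗ₘ (SquareZero.prim X₂ ⊗ₘ (SquareZero.prim X₃ ⊗ₘ (SquareZero.prim X₄ ⊗ₘ (SquareZero.prim X₅ ⊗ₘ (SquareZero.prim X₆ ⊗ₘ SquareZero.prim X₇)))))) ≫=
    h (SquareZero X₁ ⊗ (SquareZero X₂ ⊗ (SquareZero X₃ ⊗ (SquareZero X₄ ⊗ (SquareZero X₅ ⊗ (SquareZero X₆ ⊗ SquareZero X₇))))))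
      (onFst _ (pj X₁))
      (onSnd _ (onFst _ (pj X₂)))
      (onSnd _ (onSnd _ (onFst _ (pj X₃))))
      (onSnd _ (onSnd _ (onSnd _ (onFst _ (pj X₄)))))
      (onSnd _ (onSnd _ (onSnd _ (onSnd _ (onFst _ (pj X₅))))))
      (onSnd _ (onSnd _ (onSnd _ (onSnd _ (onSnd _ (onFst _ (pj X₆)))))))
      (onSnd _ (onSnd _ (onSnd _ (onSnd _ (onSnd _ (onSnd _ (pj X₇)))))))
  simpa only [← onSnd_pr, onFst_pr_onSnd, tensorHom_comp_tensorHom_assoc,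
    tensorHom_comp_tensorHom, SquareZero.prim_proj, id_tensorHom_id, Category.id_comp] using this

theorem tensor_hom_ext₂₂ [SymPair X₁ X₂] [SymPair X₁ X₃] [SymPair X₁ X₄] [SymPair X₂ X₃]
    [SymPair X₂ X₄] [SymPair X₃ X₄] {m m' : (X₁ ⊗ X₂) ⊗ (X₃ ⊗ X₄) ⟶ Z}
    (h : ∀ (K : C) [ComonObj K] [IsCommComonObj K]
      (x₁ : K ⟶ X₁) (x₂ : K ⟶ X₂) (x₃ : K ⟶ X₃) (x₄ : K ⟶ X₄),
      ((x₁ ⊠ₚ x₂) ⊠ₚ (x₃ ⊠ₚ x₄)) ≫ m = ((x₁ ⊠ₚ x₂) ⊠ₚ (x₃ ⊠ₚ x₄)) ≫ m') : m = m' := by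
  rw [← cancel_epi (α_ X₁ X₂ (X₃ ⊗ X₄)).inv]
  apply tensor_hom_ext₄
  intro K _ _ x₁ x₂ x₃ x₄
  simpa only [pr_associator_inv_assoc] using h K x₁ x₂ x₃ x₄

theorem tensor_hom_ext₂₁ [SymPair X₁ X₂] [SymPair X₁ X₃] [SymPair X₂ X₃]
    {m m' : (X₁ ⊗ X₂) ⊗ X₃ ⟶ Z}
    (h : ∀ (K : C) [ComonObj K] [IsCommComonObj K] (x₁ : K ⟶ X₁) (x₂ : K ⟶ X₂) (x₃ : K ⟶ X₃),
      ((x₁ ⊠ₚ x₂) ⊠ₚ x₃) ≫ m = ((x₁ ⊠ₚ x₂) ⊠ₚ x₃) ≫ m') : m = m' := by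
  rw [← cancel_epi (α_ X₁ X₂ X₃).inv]
  apply tensor_hom_ext₃
  intro K _ _ x₁ x₂ x₃
  simpa only [pr_associator_inv_assoc] using h K x₁ x₂ x₃

end Ext

/-! ### Adjoint action, coboundaries and the classical Yang-Baxter equation in a general braided Lie
algebra. -/

section Lie

variable {C : Type u} [Category.{v} C] [Preadditive C] [MonoidalCategory C]
  [MonoidalPreadditive C] [BraidedCategory C]

section Eval

variable {K : C} [ComonObj K] [IsCommComonObj K] {L : C} {br : L ⊗ L ⟶ L}

theorem IsSymmetricOn.symPair (h : IsSymmetricOn L) : SymPair L L := ⟨h⟩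

theorem adTensor_eval (x a b : K ⟶ L) :
    (x ⊠ₚ (a ⊠ₚ b)) ≫ adTensor L br = ((x ⊠ₚ a) ≫ br) ⊠ₚ b + a ⊠ₚ ((x ⊠ₚ b) ≫ br) := by
  simp [adTensor]

theorem adTensor_eval_assoc (x a b : K ⟶ L) {T : C} (h : L ⊗ L ⟶ T) :
    (x ⊠ₚ (a ⊠ₚ b)) ≫ adTensor L br ≫ h =
      (((x ⊠ₚ a) ≫ br) ⊠ₚ b + a ⊠ₚ ((x ⊠ₚ b) ≫ br)) ≫ h := by
  rw [← Category.assoc, adTensor_eval]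

theorem bracket_antisymm (h : (𝟙 (L ⊗ L) + (β_ L L).hom) ≫ br = 0) (x y : K ⟶ L) :
    (x ⊠ₚ y) ≫ br = -((y ⊠ₚ x) ≫ br) := by
  have := (x ⊠ₚ y) ≫= h
  simp at this
  exact eq_neg_of_add_eq_zero_left this

theorem bracket_jacobi (h : (𝟙 ((L ⊗ L) ⊗ L) + braid23 L ≫ braid12 L + braid12 L ≫ braid23 L) ≫
    br ▷ L ≫ br = 0) (x y z : K ⟶ L) :
    (((x ⊠ₚ y) ≫ br) ⊠ₚ z) ≫ br + (((z ⊠ₚ x) ≫ br) ⊠ₚ y) ≫ br +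
      (((y ⊠ₚ z) ≫ br) ⊠ₚ x) ≫ br = 0 := by
  have := ((x ⊠ₚ y) ⊠ₚ z) ≫= h
  simpa [braid12, braid23] using this

end Eval

theorem IsBraidedLieCoalgebra.comp_braiding {L : C} {cobr : L ⟶ L ⊗ L}
    (h : IsBraidedLieCoalgebra L cobr) : cobr ≫ (β_ L L).hom = -cobr := by
  have := h.coantisymm
  rw [Preadditive.comp_add, Category.comp_id] at this
  exact (neg_eq_of_add_eq_zero_right this).symm

theorem IsBraidedLieCoalgebra.neg {L : C} {cobr : L ⟶ L ⊗ L} (h : IsBraidedLieCoalgebra L cobr) :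
    IsBraidedLieCoalgebra L (-cobr) where
  symm := h.symm
  coantisymm := by rw [Preadditive.neg_comp, h.coantisymm, neg_zero]
  cojacobi := by
    simpa only [neg_whiskerRight, Preadditive.neg_comp, Preadditive.comp_neg, neg_neg] using
      h.cojacobi

theorem IsBraidedLieBialgebra.neg {L : C} {br : L ⊗ L ⟶ L} {cobr : L ⟶ L ⊗ L}
    (h : IsBraidedLieBialgebra L br cobr) : IsBraidedLieBialgebra L br (-cobr) where
  lieAlgebra := h.lieAlgebra
  lieCoalgebra := h.lieCoalgebra.neg
  compat := by
    rw [Preadditive.comp_neg, h.compat, whiskerLeft_neg, Preadditive.neg_comp, Preadditive.comp_neg]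

variable [HasBinaryBiproducts C]

/-- The tensor square of the adjoint action is a Lie action: Jacobi applies in each leg, and the
cross terms cancel in the commutator. -/
theorem adTensor_bracket {L : C} {br : L ⊗ L ⟶ L} (h : IsBraidedLieAlgebra L br)
    {K : C} [ComonObj K] [IsCommComonObj K] (x y : K ⟶ L) (t : K ⟶ L ⊗ L) :
    (((x ⊠ₚ y) ≫ br) ⊠ₚ t) ≫ adTensor L br =
      (x ⊠ₚ ((y ⊠ₚ t) ≫ adTensor L br)) ≫ adTensor L br -
        (y ⊠ₚ ((x ⊠ₚ t) ≫ adTensor L br)) ≫ adTensor L br := by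
  have := h.symm.symPair
  -- An element `t` of `L ⊗ L` need not be a product. The identity is therefore first proved between
  -- morphisms, where testing on products suffices, and is then evaluated at `t`. The same detour
  -- recurs below for the coevaluation and for R.
  have key : (α_ L L (L ⊗ L)).inv ≫ br ▷ (L ⊗ L) ≫ adTensor L br =
      L ◁ adTensor L br ≫ adTensor L br - (α_ L L (L ⊗ L)).inv ≫ (β_ L L).hom ▷ (L ⊗ L) ≫
        (α_ L L (L ⊗ L)).hom ≫ L ◁ adTensor L br ≫ adTensor L br := by
    apply tensor_hom_ext₄
    intro K _ _ x y a b
    have jac (u : K ⟶ L) : (((x ⊠ₚ y) ≫ br) ⊠ₚ u) ≫ br =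
        (x ⊠ₚ ((y ⊠ₚ u) ≫ br)) ≫ br - (y ⊠ₚ ((x ⊠ₚ u) ≫ br)) ≫ br := by
      have h1 := bracket_jacobi h.jacobi x y u
      rw [bracket_antisymm h.antisymm u x, bracket_antisymm h.antisymm _ x] at h1
      rw [bracket_antisymm h.antisymm y (_ ≫ _)]
      simp at h1 ⊢
      rw [← sub_eq_zero, ← h1]
      abel
    simp only [Preadditive.comp_sub, pr_associator_inv_assoc, pr_whiskerRight_assoc,
      pr_associator_hom_assoc, pr_braiding, pr_whiskerLeft_assoc, adTensor_eval,
      Preadditive.add_comp, pr_add, jac, pr_sub, sub_pr]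
    abel
  simpa only [Preadditive.comp_sub, pr_associator_inv_assoc, pr_whiskerRight_assoc,
      pr_associator_hom_assoc, pr_braiding, pr_whiskerLeft_assoc] using (x ⊠ₚ (y ⊠ₚ t)) ≫= key

theorem IsCoboundary.apply {L : C} {br : L ⊗ L ⟶ L} {cobr : L ⟶ L ⊗ L} {R : 𝟙_ C ⟶ L ⊗ L}
    (h : IsCoboundary L br cobr R) {K : C} [ComonObj K] [IsCommComonObj K] (x : K ⟶ L) :
    x ≫ cobr = (x ⊠ₚ ((1 : K ⟶ 𝟙_ C) ≫ R)) ≫ adTensor L br := by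
  rw [h]
  simp

/-- With δ(x) = x·R, the cocycle condition reads [x,y]·R = x·(y·R) - y·(x·R), which is the action
property. -/
theorem IsCoboundary.compat {L : C} {br : L ⊗ L ⟶ L} {cobr : L ⟶ L ⊗ L} {R : 𝟙_ C ⟶ L ⊗ L}
    (hL : IsBraidedLieAlgebra L br) (h : IsCoboundary L br cobr R) :
    br ≫ cobr = (𝟙 (L ⊗ L) - (β_ L L).hom) ≫ L ◁ cobr ≫ adTensor L br := by
  have := hL.symm.symPair
  apply tensor_hom_ext₂
  intro K _ _ x y
  simp only [Preadditive.comp_sub, Preadditive.sub_comp, pr_whiskerLeft_assoc, Category.id_comp,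
    pr_braiding_assoc, h.apply]
  rw [← Category.assoc, h.apply, adTensor_bracket hL]

/-- The first term of the classical Yang-Baxter equation, as a map on `(L ⊗ L) ⊗ (L ⊗ L)`. -/
def cybe₁ (L : C) (br : L ⊗ L ⟶ L) : (L ⊗ L) ⊗ (L ⊗ L) ⟶ L ⊗ (L ⊗ L) :=
  𝟙 _ ⊗≫ L ◁ ((β_ L L).hom ▷ L) ⊗≫ br ▷ (L ⊗ L)

/-- The second term of the classical Yang-Baxter equation, as a map on `(L ⊗ L) ⊗ (L ⊗ L)`. -/
def cybe₂ (L : C) (br : L ⊗ L ⟶ L) : (L ⊗ L) ⊗ (L ⊗ L) ⟶ L ⊗ (L ⊗ L) :=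
  𝟙 _ ⊗≫ L ◁ (br ▷ L)

/-- The third term of the classical Yang-Baxter equation, as a map on `(L ⊗ L) ⊗ (L ⊗ L)`. -/
def cybe₃ (L : C) (br : L ⊗ L ⟶ L) : (L ⊗ L) ⊗ (L ⊗ L) ⟶ L ⊗ (L ⊗ L) :=
  𝟙 _ ⊗≫ L ◁ ((β_ L L).hom ▷ L) ⊗≫ L ◁ (L ◁ br)

section
variable {L : C} {br : L ⊗ L ⟶ L} {K : C} [ComonObj K] [IsCommComonObj K] (a b c d : K ⟶ L)

theorem cybe₁_eval : ((a ⊠ₚ b) ⊠ₚ (c ⊠ₚ d)) ≫ cybe₁ L br = ((a ⊠ₚ c) ≫ br) ⊠ₚ (b ⊠ₚ d) := by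
  simp [cybe₁, monoidalComp]

theorem cybe₁_eval_assoc {T : C} (h : L ⊗ L ⊗ L ⟶ T) :
    ((a ⊠ₚ b) ⊠ₚ (c ⊠ₚ d)) ≫ cybe₁ L br ≫ h = (((a ⊠ₚ c) ≫ br) ⊠ₚ (b ⊠ₚ d)) ≫ h := by
  rw [← Category.assoc, cybe₁_eval]

theorem cybe₂_eval : ((a ⊠ₚ b) ⊠ₚ (c ⊠ₚ d)) ≫ cybe₂ L br = a ⊠ₚ (((b ⊠ₚ c) ≫ br) ⊠ₚ d) := by
  simp [cybe₂, monoidalComp]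

theorem cybe₂_eval_assoc {T : C} (h : L ⊗ L ⊗ L ⟶ T) :
    ((a ⊠ₚ b) ⊠ₚ (c ⊠ₚ d)) ≫ cybe₂ L br ≫ h = (a ⊠ₚ (((b ⊠ₚ c) ≫ br) ⊠ₚ d)) ≫ h := by
  rw [← Category.assoc, cybe₂_eval]

theorem cybe₃_eval : ((a ⊠ₚ b) ⊠ₚ (c ⊠ₚ d)) ≫ cybe₃ L br = a ⊠ₚ (c ⊠ₚ ((b ⊠ₚ d) ≫ br)) := by
  simp [cybe₃, monoidalComp]

theorem cybe₃_eval_assoc {T : C} (h : L ⊗ L ⊗ L ⟶ T) :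
    ((a ⊠ₚ b) ⊠ₚ (c ⊠ₚ d)) ≫ cybe₃ L br ≫ h = (a ⊠ₚ (c ⊠ₚ ((b ⊠ₚ d) ≫ br))) ≫ h := by
  rw [← Category.assoc, cybe₃_eval]

end

theorem isCYBE_iff {L : C} {br : L ⊗ L ⟶ L} {R : 𝟙_ C ⟶ L ⊗ L} :
    IsCYBE L br R ↔ ∀ (K : C) [ComonObj K] [IsCommComonObj K],
      (((1 : K ⟶ 𝟙_ C) ≫ R) ⊠ₚ ((1 : K ⟶ 𝟙_ C) ≫ R)) ≫
        (cybe₁ L br + cybe₂ L br + cybe₃ L br) = 0 := by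
  have h : IsCYBE L br R ↔ (λ_ (𝟙_ C)).inv ≫ (R ⊗ₘ R) ≫
      (cybe₁ L br + cybe₂ L br + cybe₃ L br) = 0 := by
    simp [IsCYBE, cybe₁, cybe₂, cybe₃, monoidalComp]
  have e {K : C} [ComonObj K] [IsCommComonObj K] {Z : C} (m : (L ⊗ L) ⊗ (L ⊗ L) ⟶ Z) :
      (1 : K ⟶ 𝟙_ C) ≫ (λ_ (𝟙_ C)).inv ≫ (R ⊗ₘ R) ≫ m =
      (((1 : K ⟶ 𝟙_ C) ≫ R) ⊠ₚ ((1 : K ⟶ 𝟙_ C) ≫ R)) ≫ m := by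
    rw [comp_leftUnitor_inv_eq_assoc, pr_tensorHom_assoc]
  rw [h]
  constructor
  · intro h K _ _
    rw [← e, h, comp_zero]
  · intro h
    apply unit_hom_ext_elements
    intro K _ _
    rw [e, h, comp_zero]

/-- For a coboundary, two of the three terms of the classical Yang-Baxter equation add up to
`(id ⊗ δ) R`. -/
theorem IsCoboundary.cybe₂_add_cybe₃ {L : C} [SymPair L L] {br : L ⊗ L ⟶ L} {cobr : L ⟶ L ⊗ L}
    {R : 𝟙_ C ⟶ L ⊗ L} (h : IsCoboundary L br cobr R) {K : C} [ComonObj K] [IsCommComonObj K]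
    (t : K ⟶ L ⊗ L) :
    (t ⊠ₚ ((1 : K ⟶ 𝟙_ C) ≫ R)) ≫ (cybe₂ L br + cybe₃ L br) = t ≫ L ◁ cobr := by
  -- Both terms bracket the second leg of the first tensor with a leg of the second tensor; together
  -- they are the adjoint action on the latter.
  have key : cybe₂ L br + cybe₃ L br = (α_ L L (L ⊗ L)).hom ≫ L ◁ adTensor L br := by
    apply tensor_hom_ext₂₂
    intro K _ _ a b c d
    simp [cybe₂_eval, cybe₃_eval, adTensor_eval]
  have key2 : L ◁ cobr = (ρ_ (L ⊗ L)).inv ≫ (L ⊗ L) ◁ R ≫ (cybe₂ L br + cybe₃ L br) := by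
    apply tensor_hom_ext₂
    intro K _ _ a b
    simp only [comp_rightUnitor_inv_eq_assoc, pr_whiskerLeft_assoc, pr_whiskerLeft, key,
      pr_associator_hom_assoc, h.apply]
  rw [key2]
  simp only [comp_rightUnitor_inv_eq_assoc, pr_whiskerLeft_assoc]

/-- Flipping both copies of R amounts, up to sign, to exchanging the two copies and reversing the
three output legs. The first and third terms trade places, antisymmetry gives the sign, and R ⊗ R is
unchanged by the exchange. -/
theorem IsCYBE.flip {L : C} {br : L ⊗ L ⟶ L} {R : 𝟙_ C ⟶ L ⊗ L} (hL : IsBraidedLieAlgebra L br)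
    (h : IsCYBE L br R) : IsCYBE L br (R ≫ (β_ L L).hom) := by
  have := hL.symm.symPair
  rw [isCYBE_iff] at h ⊢
  intro K _ _
  have key : ((β_ L L).hom ⊗ₘ (β_ L L).hom) ≫ (cybe₁ L br + cybe₂ L br + cybe₃ L br) =
      -((β_ (L ⊗ L) (L ⊗ L)).hom ≫ (cybe₁ L br + cybe₂ L br + cybe₃ L br) ≫
        (β_ L (L ⊗ L)).hom ≫ (β_ L L).hom ▷ L ≫ (α_ L L L).hom) := by
    apply tensor_hom_ext₂₂
    intro K _ _ a b c d
    simp only [pr_tensorHom_assoc, pr_braiding, pr_braiding_assoc, Preadditive.comp_add,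
      Preadditive.add_comp, Preadditive.comp_neg, pr_whiskerRight_assoc, pr_associator_hom,
      cybe₁_eval, cybe₂_eval, cybe₃_eval, cybe₁_eval_assoc, cybe₂_eval_assoc, cybe₃_eval_assoc,
      bracket_antisymm hL.antisymm c a, bracket_antisymm hL.antisymm d b,
      bracket_antisymm hL.antisymm d a, pr_neg, neg_pr, Preadditive.neg_comp]
    abel
  have h1 := (((1 : K ⟶ 𝟙_ C) ≫ R) ⊠ₚ ((1 : K ⟶ 𝟙_ C) ≫ R)) ≫= key
  rw [Preadditive.comp_neg, pr_braiding_assoc, reassoc_of% (h K), zero_comp, neg_zero,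
    pr_tensorHom_assoc] at h1
  simpa using h1

/-- The adjoint action commutes with the flip, so the flip of R has coboundary equal to the flip of
δ, which is -δ. -/
theorem IsQuasitriangular.flip {L : C} {br : L ⊗ L ⟶ L} {cobr : L ⟶ L ⊗ L} {R : 𝟙_ C ⟶ L ⊗ L}
    (h : IsQuasitriangular L br cobr R) :
    IsQuasitriangular L br (-cobr) (R ≫ (β_ L L).hom) := by
  have hL := h.lieBialgebra.lieAlgebra
  have := hL.symm.symPair
  have hco : IsCoboundary L br (-cobr) (R ≫ (β_ L L).hom) := by
    have key : adTensor L br ≫ (β_ L L).hom = L ◁ (β_ L L).hom ≫ adTensor L br := by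
      apply tensor_hom_ext₃
      intro K _ _ x a b
      simp [adTensor_eval, adTensor_eval_assoc, add_comm]
    rw [IsCoboundary, ← h.lieBialgebra.lieCoalgebra.comp_braiding]
    conv_lhs => rw [h.coboundary]
    simp [key]
  exact
  { lieBialgebra :=
    { lieAlgebra := hL
      lieCoalgebra := h.lieBialgebra.lieCoalgebra.neg
      compat := hco.compat hL }
    coboundary := hco
    cybe := h.cybe.flip hL }

end Lie

/-! ### Pairings, transposition, and the Lie structures on the dual. -/

section Dual

variable {C : Type u} [Category.{v} C] [MonoidalCategory C]

/-- Contraction of the last tensor factor with a pairing. -/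
def contract {X Y : C} (W : C) (p : X ⊗ Y ⟶ 𝟙_ C) : (W ⊗ X) ⊗ Y ⟶ W :=
  (α_ W X Y).hom ≫ W ◁ p ≫ (ρ_ W).hom

/-- A pairing `p : X ⊗ Y ⟶ I` is nondegenerate if morphisms into `W ⊗ X` are detected by their
contractions with `Y`. -/
def Nondegenerate {X Y : C} (p : X ⊗ Y ⟶ 𝟙_ C) : Prop :=
  ∀ ⦃Z W : C⦄ ⦃m m' : Z ⟶ W ⊗ X⦄, m ▷ Y ≫ contract W p = m' ▷ Y ≫ contract W p → m = m'

theorem nondegenerate_evaluation (H Hd : C) [ExactPairing H Hd] :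
    Nondegenerate (ExactPairing.evaluation H Hd) := by
  intro Z W m m' h
  exact (tensorRightHomEquiv Z H Hd W).symm.injective h

/-- A pairing `p : X ⊗ Y ⟶ I` is separating if morphisms into `X` are detected by their pairings
with `Y`. -/
def Separating {X Y : C} (p : X ⊗ Y ⟶ 𝟙_ C) : Prop :=
  ∀ ⦃Z : C⦄ ⦃m m' : Z ⟶ X⦄, m ▷ Y ≫ p = m' ▷ Y ≫ p → m = m'

theorem Nondegenerate.separating {X Y : C} {p : X ⊗ Y ⟶ 𝟙_ C} (hp : Nondegenerate p) :
    Separating p := by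
  intro Z m m' h
  rw [← cancel_mono (λ_ X).inv]
  apply hp
  have e : (λ_ X).inv ▷ Y ≫ contract (𝟙_ C) p = p := by
    rw [contract, ← unitors_equal]
    simp
  rw [comp_whiskerRight, comp_whiskerRight, Category.assoc, Category.assoc, e, h]

theorem coevaluation_contract (H Hd : C) [ExactPairing H Hd] :
    (ExactPairing.coevaluation H Hd) ▷ H ≫ contract H (ExactPairing.evaluation H Hd) =
      (λ_ H).hom := by
  simp [contract]

variable [BraidedCategory C]

theorem nondegenerate_braiding_evaluation (H Hd : C) [ExactPairing H Hd] :
    Nondegenerate ((β_ H Hd).hom ≫ ExactPairing.evaluation H Hd) :=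
  letI := BraidedCategory.exactPairing_swap H Hd
  nondegenerate_evaluation Hd H

variable [Preadditive C] [MonoidalPreadditive C] {K : C} [ComonObj K] [IsCommComonObj K]

@[simp] theorem pr_contract {X Y W : C} (p : X ⊗ Y ⟶ 𝟙_ C) (w : K ⟶ W) (x : K ⟶ X) (y : K ⟶ Y) :
    ((w ⊠ₚ x) ⊠ₚ y) ≫ contract W p = ((x ⊠ₚ y) ≫ p) • w := by
  simp [contract]

@[simp] theorem pr_contract_assoc {X Y W : C} (p : X ⊗ Y ⟶ 𝟙_ C) (w : K ⟶ W) (x : K ⟶ X)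
    (y : K ⟶ Y) {T : C} (h : W ⟶ T) :
    ((w ⊠ₚ x) ⊠ₚ y) ≫ contract W p ≫ h = (((x ⊠ₚ y) ≫ p) • w) ≫ h := by
  rw [← Category.assoc, pr_contract]

theorem pr_tensorμ {X Y Z W : C} (x : K ⟶ X) (y : K ⟶ Y) (z : K ⟶ Z) (w : K ⟶ W) :
    ((x ⊠ₚ y) ⊠ₚ (z ⊠ₚ w)) ≫ tensorμ X Y Z W = (x ⊠ₚ z) ⊠ₚ (y ⊠ₚ w) := by
  simp only [tensorμ, pr_associator_hom_assoc, pr_whiskerLeft_assoc, pr_associator_inv,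
    pr_whiskerRight, pr_braiding, pr_associator_hom]

theorem pr_tensorμ_assoc {X Y Z W : C} (x : K ⟶ X) (y : K ⟶ Y) (z : K ⟶ Z) (w : K ⟶ W) {T : C}
    (h : _ ⟶ T) : ((x ⊠ₚ y) ⊠ₚ (z ⊠ₚ w)) ≫ tensorμ X Y Z W ≫ h =
      ((x ⊠ₚ z) ⊠ₚ (y ⊠ₚ w)) ≫ h := by
  rw [← Category.assoc, pr_tensorμ]

/-- The tensor product of two pairings. -/
def pairTensor {X Y X' Y' : C} (p : X ⊗ Y ⟶ 𝟙_ C) (q : X' ⊗ Y' ⟶ 𝟙_ C) :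
    (X ⊗ X') ⊗ (Y ⊗ Y') ⟶ 𝟙_ C :=
  tensorμ X X' Y Y' ≫ (p ⊗ₘ q) ≫ (λ_ (𝟙_ C)).hom

@[simp] theorem pairTensor_eval {X Y X' Y' : C} (p : X ⊗ Y ⟶ 𝟙_ C) (q : X' ⊗ Y' ⟶ 𝟙_ C)
    (x : K ⟶ X) (x' : K ⟶ X') (y : K ⟶ Y) (y' : K ⟶ Y') :
    ((x ⊠ₚ x') ⊠ₚ (y ⊠ₚ y')) ≫ pairTensor p q = ((x ⊠ₚ y) ≫ p) * ((x' ⊠ₚ y') ≫ q) := by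
  simp [pairTensor, pr_tensorμ_assoc]

variable (H Hd : C) [ExactPairing H Hd]

/-- The pairing of `H* ⊗ H*` with `H ⊗ H`. -/
abbrev ev₂ : (Hd ⊗ Hd) ⊗ (H ⊗ H) ⟶ 𝟙_ C := pairTensor (ev H Hd) (ev H Hd)

/-- The pairing of `H* ⊗ H* ⊗ H*` with `H ⊗ H ⊗ H`. -/
abbrev ev₃ : ((Hd ⊗ Hd) ⊗ Hd) ⊗ ((H ⊗ H) ⊗ H) ⟶ 𝟙_ C := pairTensor (ev₂ H Hd) (ev H Hd)

@[simp] theorem one_coev_contract (x : K ⟶ H) :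
    (((1 : K ⟶ 𝟙_ C) ≫ coev H Hd) ⊠ₚ x) ≫ contract H (ev H Hd) = x := by
  have := ((1 : K ⟶ 𝟙_ C) ⊠ₚ x) ≫= coevaluation_contract H Hd
  simpa using this

variable [HasBinaryBiproducts C] [SymPair H H] [SymPair H Hd] [SymPair Hd H] [SymPair Hd Hd]

variable {H} (cobr : H ⟶ H ⊗ H) (br : H ⊗ H ⟶ H)

variable (H) in
theorem one_coev_coev_contract (t : K ⟶ H ⊗ H) :
    ((((1 : K ⟶ 𝟙_ C) ≫ coev H Hd) ⊠ₚ ((1 : K ⟶ 𝟙_ C) ≫ coev H Hd)) ⊠ₚ t) ≫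
      tensorμ (H ⊗ Hd) (H ⊗ Hd) H H ≫ (contract H (ev H Hd) ⊗ₘ contract H (ev H Hd)) = t := by
  have h : (λ_ (H ⊗ H)).inv ≫ ((λ_ (𝟙_ C)).inv ≫ (coev H Hd ⊗ₘ coev H Hd)) ▷ (H ⊗ H) ≫
      tensorμ (H ⊗ Hd) (H ⊗ Hd) H H ≫ (contract H (ev H Hd) ⊗ₘ contract H (ev H Hd)) = 𝟙 _ := by
    apply tensor_hom_ext₂
    intro K _ _ x y
    rw [comp_leftUnitor_inv_eq_assoc, pr_whiskerRight_assoc, comp_leftUnitor_inv_eq_assoc,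
      pr_tensorHom, pr_tensorμ_assoc, pr_tensorHom, one_coev_contract, one_coev_contract,
      Category.comp_id]
  have h' := t ≫= h
  rwa [comp_leftUnitor_inv_eq_assoc, pr_whiskerRight_assoc, comp_leftUnitor_inv_eq_assoc,
    pr_tensorHom, Category.comp_id] at h'

variable (H) in
theorem one_coev_coev_contract_assoc (t : K ⟶ H ⊗ H) {T : C} (h : H ⊗ H ⟶ T) :
    ((((1 : K ⟶ 𝟙_ C) ≫ coev H Hd) ⊠ₚ ((1 : K ⟶ 𝟙_ C) ≫ coev H Hd)) ⊠ₚ t) ≫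
      tensorμ (H ⊗ Hd) (H ⊗ Hd) H H ≫ (contract H (ev H Hd) ⊗ₘ contract H (ev H Hd)) ≫ h =
      t ≫ h := by
  conv_rhs => rw [← one_coev_coev_contract H Hd t]
  simp only [Category.assoc]

/-- The output of the bracket is the dual leg of a coevaluation. Pairing it with `x` straightens the
snake and puts `x` in place of the basis vector fed to `cobr`. -/
theorem dualBracket_ev (F : K ⟶ Hd ⊗ Hd) (x : K ⟶ H) :
    ((F ≫ dualBracket H Hd cobr) ⊠ₚ x) ≫ ev H Hd = (F ⊠ₚ (x ≫ cobr)) ≫ ev₂ H Hd := by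
  have h1 : dualBracket H Hd cobr = (ρ_ (Hd ⊗ Hd)).inv ≫ (Hd ⊗ Hd) ◁ (coev H Hd ≫ cobr ▷ Hd) ≫
      (α_ _ _ _).inv ≫ ev₂ H Hd ▷ Hd ≫ (λ_ Hd).hom := by
    simp only [dualBracket, ev₂, pairTensor, tensorμ, monoidalComp]
    monoidal
  have h2 : (((α_ (Hd ⊗ Hd) (H ⊗ H) Hd).inv ≫ ev₂ H Hd ▷ Hd ≫ (λ_ Hd).hom) ▷ H ≫ ev H Hd) =
      (α_ _ _ _).hom ≫ (Hd ⊗ Hd) ◁ contract (H ⊗ H) (ev H Hd) ≫ ev₂ H Hd := by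
    rw [← cancel_epi ((α_ (Hd ⊗ Hd) ((H ⊗ H) ⊗ Hd) H).inv),
      ← cancel_epi ((Hd ⊗ Hd) ◁ (α_ (H ⊗ H) Hd H).inv)]
    apply tensor_hom_ext₄
    intro K _ _ F t f x
    simp [-tensor_whiskerLeft, -whiskerRight_tensor, mul_comm]
  have h3 : (F ≫ dualBracket H Hd cobr) = (F ⊠ₚ (((1 : K ⟶ 𝟙_ C) ≫ coev H Hd) ≫ cobr ▷ Hd)) ≫
      (α_ _ _ _).inv ≫ ev₂ H Hd ▷ Hd ≫ (λ_ Hd).hom := by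
    rw [h1, comp_rightUnitor_inv_eq_assoc, pr_whiskerLeft_assoc, Category.assoc]
  have h4 : (cobr ▷ Hd) ▷ H ≫ contract (H ⊗ H) (ev H Hd) = contract H (ev H Hd) ≫ cobr := by
    apply tensor_hom_ext₂₁
    intro K _ _ x f y
    simp
  rw [h3, ← pr_whiskerRight, Category.assoc, h2, pr_associator_hom_assoc, pr_whiskerLeft_assoc,
    ← pr_whiskerRight, Category.assoc, h4, ← Category.assoc, one_coev_contract]

theorem dualCobracket_ev (f : K ⟶ Hd) (t : K ⟶ H ⊗ H) :
    ((f ≫ dualCobracket H Hd br) ⊠ₚ t) ≫ ev₂ H Hd = (f ⊠ₚ (t ≫ br)) ≫ ev H Hd := by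
  -- `M` is the dual cobracket with its two coevaluations replaced by free inputs, so that it can be
  -- tested on product elements.
  let M : Hd ⊗ ((H ⊗ Hd) ⊗ (H ⊗ Hd)) ⟶ Hd ⊗ Hd :=
    𝟙 _ ⊗≫ Hd ◁ (H ◁ ((β_ Hd H).hom ▷ Hd)) ⊗≫ Hd ◁ (br ▷ (Hd ⊗ Hd)) ⊗≫
      ev H Hd ▷ (Hd ⊗ Hd) ⊗≫ 𝟙 (Hd ⊗ Hd)
  have h1 : dualCobracket H Hd br = (ρ_ Hd).inv ≫ Hd ◁ ((λ_ _).inv ≫ (coev H Hd ⊗ₘ coev H Hd)) ≫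
      M := by
    simp only [dualCobracket, M, monoidalComp]
    monoidal
  have hM {K : C} [ComonObj K] [IsCommComonObj K] (f φ ψ : K ⟶ Hd) (x y : K ⟶ H) :
      (f ⊠ₚ ((x ⊠ₚ φ) ⊠ₚ (y ⊠ₚ ψ))) ≫ M = ((f ⊠ₚ ((x ⊠ₚ y) ≫ br)) ≫ ev H Hd) • (φ ⊠ₚ ψ) := by
    simp [M, monoidalComp]
  have h2 : M ▷ (H ⊗ H) ≫ ev₂ H Hd = (α_ _ _ _).hom ≫
      Hd ◁ (tensorμ (H ⊗ Hd) (H ⊗ Hd) H H ≫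
        (contract H (ev H Hd) ⊗ₘ contract H (ev H Hd)) ≫ br) ≫ ev H Hd := by
    rw [← cancel_epi (monoidalIso (Hd ⊗ H ⊗ Hd ⊗ H ⊗ Hd ⊗ H ⊗ H)
      ((Hd ⊗ ((H ⊗ Hd) ⊗ (H ⊗ Hd))) ⊗ (H ⊗ H))).hom]
    apply tensor_hom_ext₇
    intro K _ _ f x φ y ψ z w
    have e : (f ⊠ₚ (x ⊠ₚ (φ ⊠ₚ (y ⊠ₚ (ψ ⊠ₚ (z ⊠ₚ w)))))) ≫ (monoidalIso
        (Hd ⊗ H ⊗ Hd ⊗ H ⊗ Hd ⊗ H ⊗ H) ((Hd ⊗ ((H ⊗ Hd) ⊗ (H ⊗ Hd))) ⊗ (H ⊗ H))).hom =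
        (f ⊠ₚ ((x ⊠ₚ φ) ⊠ₚ (y ⊠ₚ ψ))) ⊠ₚ (z ⊠ₚ w) := by simp
    rw [reassoc_of% e, reassoc_of% e]
    simp only [pr_whiskerRight_assoc, hM, smul_pr, smul_comp_eq, pairTensor_eval, pr_associator_hom_assoc,
      pr_whiskerLeft_assoc, pr_tensorμ_assoc, pr_tensorHom_assoc, pr_contract, pr_smul, smul_scalar]
    ring
  have h3 : f ≫ dualCobracket H Hd br = (f ⊠ₚ (((1 : K ⟶ 𝟙_ C) ≫ coev H Hd) ⊠ₚ
      ((1 : K ⟶ 𝟙_ C) ≫ coev H Hd))) ≫ M := by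
    rw [h1, comp_rightUnitor_inv_eq_assoc, pr_whiskerLeft_assoc, comp_leftUnitor_inv_eq_assoc,
      pr_tensorHom]
  rw [h3, ← pr_whiskerRight, Category.assoc, h2, pr_associator_hom_assoc, pr_whiskerLeft_assoc,
    one_coev_coev_contract_assoc]

theorem contract_comp_pairing {X Y X' Y' : C} [SymPair X X'] [SymPair X Y] [SymPair X Y']
    [SymPair X' Y] [SymPair X' Y'] [SymPair Y' Y] (p : X ⊗ Y ⟶ 𝟙_ C) (q : X' ⊗ Y' ⟶ 𝟙_ C) :
    contract X q ▷ Y ≫ p =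
      (α_ (X ⊗ X') Y' Y).hom ≫ (X ⊗ X') ◁ (β_ Y' Y).hom ≫ pairTensor p q := by
  rw [← cancel_epi (α_ (X ⊗ X') Y' Y).inv]
  apply tensor_hom_ext₂₂
  intro K _ _ x x' y' y
  simp only [pr_associator_inv_assoc, pr_whiskerRight_assoc, pr_contract, smul_pr, smul_comp_eq,
    pr_associator_hom_assoc, pr_whiskerLeft_assoc, pr_braiding, pairTensor_eval, smul_scalar]
  ring

/-- Contract with `Y'` first, then pair with `Y`. The first step needs `q` nondegenerate in the
strong sense, with a spectator factor `X`. -/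
theorem Separating.tensor {X Y X' Y' : C} [SymPair X X'] [SymPair X Y] [SymPair X Y']
    [SymPair X' Y] [SymPair X' Y'] [SymPair Y' Y] {p : X ⊗ Y ⟶ 𝟙_ C} {q : X' ⊗ Y' ⟶ 𝟙_ C}
    (hp : Separating p) (hq : Nondegenerate q) : Separating (pairTensor p q) := by
  intro Z m m' h
  apply hq
  apply hp
  simp only [comp_whiskerRight, Category.assoc, contract_comp_pairing,
    associator_naturality_left_assoc, ← whisker_exchange_assoc, h]

/-- Adjoint morphisms with respect to two pairings. -/
def IsAdjoint {X Y X' Y' : C} (p : X ⊗ Y ⟶ 𝟙_ C) (p' : X' ⊗ Y' ⟶ 𝟙_ C) (f : X ⟶ X') (g : Y' ⟶ Y) :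
    Prop := f ▷ Y' ≫ p' = X ◁ g ≫ p

namespace IsAdjoint

variable {X Y X' Y' X'' Y'' : C} {p : X ⊗ Y ⟶ 𝟙_ C} {p' : X' ⊗ Y' ⟶ 𝟙_ C} {p'' : X'' ⊗ Y'' ⟶ 𝟙_ C}

theorem id : IsAdjoint p p (𝟙 X) (𝟙 Y) := by simp [IsAdjoint]

theorem comp {f : X ⟶ X'} {g : Y' ⟶ Y} {f' : X' ⟶ X''} {g' : Y'' ⟶ Y'} (h : IsAdjoint p p' f g)
    (h' : IsAdjoint p' p'' f' g') : IsAdjoint p p'' (f ≫ f') (g' ≫ g) := by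
  unfold IsAdjoint at *
  rw [comp_whiskerRight, Category.assoc, h', ← whisker_exchange_assoc, h,
    MonoidalCategory.whiskerLeft_comp, Category.assoc]

theorem add {f f' : X ⟶ X'} {g g' : Y' ⟶ Y} (h : IsAdjoint p p' f g) (h' : IsAdjoint p p' f' g') :
    IsAdjoint p p' (f + f') (g + g') := by
  unfold IsAdjoint at *
  rw [MonoidalPreadditive.add_whiskerRight, MonoidalPreadditive.whiskerLeft_add,
    Preadditive.add_comp, Preadditive.add_comp, h, h']

theorem eq_zero {f : X ⟶ X'} (hp : Separating p') (h : IsAdjoint p p' f 0) : f = 0 := by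
  apply hp
  rw [h]
  simp

theorem whiskerRight {f : X ⟶ X'} {g : Y' ⟶ Y} (h : IsAdjoint p p' f g) :
    IsAdjoint (pairTensor p p'') (pairTensor p' p'') (f ▷ X'') (g ▷ Y'') := by
  unfold IsAdjoint at *
  have e1 : (f ▷ X'') ▷ (Y' ⊗ Y'') ≫ tensorμ X' X'' Y' Y'' =
      tensorμ X X'' Y' Y'' ≫ (f ▷ Y') ▷ (X'' ⊗ Y'') := by
    simpa using tensorμ_natural_left f (𝟙 X'') Y' Y''
  have e2 : (X ⊗ X'') ◁ (g ▷ Y'') ≫ tensorμ X X'' Y Y'' =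
      tensorμ X X'' Y' Y'' ≫ (X ◁ g) ▷ (X'' ⊗ Y'') := by
    simpa using tensorμ_natural_right X X'' g (𝟙 Y'')
  simp only [pairTensor]
  rw [reassoc_of% e1, reassoc_of% e2, whiskerRight_comp_tensorHom_assoc,
    whiskerRight_comp_tensorHom_assoc, h]

end IsAdjoint

theorem isAdjoint_braiding : IsAdjoint (ev₂ H Hd) (ev₂ H Hd) (β_ Hd Hd).hom (β_ H H).hom := by
  apply tensor_hom_ext₂₂
  intro K _ _ f g x y
  simp [mul_comm, -whiskerRight_tensor, -tensor_whiskerLeft]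

theorem isAdjoint_braid12 : IsAdjoint (ev₃ H Hd) (ev₃ H Hd) (braid12 Hd) (braid12 H) :=
  (isAdjoint_braiding Hd).whiskerRight

theorem isAdjoint_braid23 : IsAdjoint (ev₃ H Hd) (ev₃ H Hd) (braid23 Hd) (braid23 H) := by
  rw [IsAdjoint, ← cancel_epi (monoidalIso (Hd ⊗ Hd ⊗ Hd ⊗ H ⊗ H ⊗ H)
      (((Hd ⊗ Hd) ⊗ Hd) ⊗ ((H ⊗ H) ⊗ H))).hom]
  apply tensor_hom_ext₆
  intro K _ _ f g h x y z
  have e : (f ⊠ₚ (g ⊠ₚ (h ⊠ₚ (x ⊠ₚ (y ⊠ₚ z))))) ≫ (monoidalIso (Hd ⊗ Hd ⊗ Hd ⊗ H ⊗ H ⊗ H)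
      (((Hd ⊗ Hd) ⊗ Hd) ⊗ ((H ⊗ H) ⊗ H))).hom = ((f ⊠ₚ g) ⊠ₚ h) ⊠ₚ ((x ⊠ₚ y) ⊠ₚ z) := by simp
  rw [reassoc_of% e, reassoc_of% e]
  simp only [braid23, pr_whiskerRight_assoc, pr_whiskerLeft_assoc, pr_associator_hom_assoc,
    pr_associator_inv, pr_braiding, pairTensor_eval]
  ring

theorem isAdjoint_dualBracket :
    IsAdjoint (ev₂ H Hd) (ev H Hd) (dualBracket H Hd cobr) cobr := by
  apply tensor_hom_ext₂
  intro K _ _ F x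
  rw [pr_whiskerRight_assoc, pr_whiskerLeft_assoc, dualBracket_ev]

theorem isAdjoint_dualCobracket :
    IsAdjoint (ev H Hd) (ev₂ H Hd) (dualCobracket H Hd br) br := by
  apply tensor_hom_ext₂
  intro K _ _ f t
  rw [pr_whiskerRight_assoc, pr_whiskerLeft_assoc, dualCobracket_ev]

/-- Each axiom is the transpose of the corresponding coalgebra axiom, and a map whose transpose
vanishes is zero because evaluation separates. -/
theorem isBraidedLieAlgebra_dual (h : IsBraidedLieCoalgebra H cobr) :
    IsBraidedLieAlgebra Hd (dualBracket H Hd cobr) where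
  symm := SymPair.braiding_braiding
  antisymm := by
    apply IsAdjoint.eq_zero (nondegenerate_evaluation H Hd).separating (p := ev₂ H Hd)
    rw [← h.coantisymm]
    exact (IsAdjoint.id.add (isAdjoint_braiding Hd)).comp (isAdjoint_dualBracket Hd cobr)
  jacobi := by
    apply IsAdjoint.eq_zero (nondegenerate_evaluation H Hd).separating (p := ev₃ H Hd)
    have h12 := isAdjoint_braid12 (H := H) Hd
    have h23 := isAdjoint_braid23 (H := H) Hd
    have := ((IsAdjoint.id.add (h23.comp h12)).add (h12.comp h23)).comp
      ((isAdjoint_dualBracket Hd cobr).whiskerRight.comp (isAdjoint_dualBracket Hd cobr))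
    -- Transposition reverses composites, so the two cyclic permutations have changed places.
    rw [add_right_comm (𝟙 ((H ⊗ H) ⊗ H)), Category.assoc, h.cojacobi] at this
    exact this

theorem separating_ev₂ : Separating (ev₂ H Hd) :=
  (nondegenerate_evaluation H Hd).separating.tensor (nondegenerate_evaluation H Hd)

theorem separating_ev₃ : Separating (ev₃ H Hd) :=
  (separating_ev₂ (H := H) Hd).tensor (nondegenerate_evaluation H Hd)

theorem isBraidedLieCoalgebra_dual (h : IsBraidedLieAlgebra H br) :
    IsBraidedLieCoalgebra Hd (dualCobracket H Hd br) where
  symm := SymPair.braiding_braiding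
  coantisymm := by
    apply IsAdjoint.eq_zero (separating_ev₂ (H := H) Hd) (p := ev H Hd)
    rw [← h.antisymm]
    exact (isAdjoint_dualCobracket Hd br).comp (IsAdjoint.id.add (isAdjoint_braiding Hd))
  cojacobi := by
    apply IsAdjoint.eq_zero (separating_ev₃ (H := H) Hd) (p := ev H Hd)
    have h12 := isAdjoint_braid12 (H := H) Hd
    have h23 := isAdjoint_braid23 (H := H) Hd
    have := (isAdjoint_dualCobracket Hd br).comp ((isAdjoint_dualCobracket Hd br).whiskerRight.comp
      ((IsAdjoint.id.add (h23.comp h12)).add (h12.comp h23)))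
    rw [add_right_comm (𝟙 ((H ⊗ H) ⊗ H)), Category.assoc, h.jacobi] at this
    exact this

/-- Together with `opLeftAct_ev` this identifies the two actions of the double as coadjoint actions.
All later computations use only these two formulas. -/
theorem opRightAct_ev (g f : K ⟶ Hd) (x : K ⟶ H) :
    (g ⊠ₚ ((x ⊠ₚ f) ≫ opRightAct H Hd cobr)) ≫ ev H Hd =
      (((g ⊠ₚ f) ≫ dualBracket H Hd cobr) ⊠ₚ x) ≫ ev H Hd := by
  have h1 : opRightAct H Hd cobr = cobr ▷ Hd ≫ contract H ((β_ H Hd).hom ≫ ev H Hd) := by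
    simp only [opRightAct, contract, monoidalComp]
    monoidal
  have h2 : Hd ◁ contract H ((β_ H Hd).hom ≫ ev H Hd) ≫ ev H Hd =
      Hd ◁ (β_ (H ⊗ H) Hd).hom ≫ (α_ _ _ _).inv ≫ ev₂ H Hd := by
    rw [← cancel_epi (Hd ◁ (α_ H H Hd).inv)]
    apply tensor_hom_ext₄
    intro K _ _ f x y g
    simp [mul_comm, -tensor_whiskerLeft, -whiskerRight_tensor]
  have h3 := (g ⊠ₚ ((x ≫ cobr) ⊠ₚ f)) ≫= h2
  rw [pr_whiskerLeft_assoc, pr_whiskerLeft_assoc, pr_braiding, pr_associator_inv_assoc] at h3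
  rw [dualBracket_ev, ← h3, h1, pr_whiskerRight_assoc]

theorem opLeftAct_ev (f : K ⟶ Hd) (x y : K ⟶ H) :
    (((x ⊠ₚ f) ≫ opLeftAct H Hd (dualCobracket H Hd br)) ⊠ₚ y) ≫ ev H Hd =
      (f ⊠ₚ ((y ⊠ₚ x) ≫ br)) ≫ ev H Hd := by
  have h1 : opLeftAct H Hd (dualCobracket H Hd br) =
      H ◁ dualCobracket H Hd br ≫ (β_ H (Hd ⊗ Hd)).hom ≫ contract Hd (ev H Hd) := by
    simp only [opLeftAct, contract, monoidalComp, BraidedCategory.braiding_tensor_right_hom]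
    monoidal
  have h2 : contract Hd (ev H Hd) ▷ H ≫ ev H Hd =
      (α_ _ _ _).hom ≫ (Hd ⊗ Hd) ◁ (β_ H H).hom ≫ ev₂ H Hd :=
    contract_comp_pairing _ _
  rw [← dualCobracket_ev, h1, pr_whiskerLeft_assoc, pr_braiding_assoc, ← pr_whiskerRight,
    Category.assoc, h2, pr_associator_hom_assoc, pr_whiskerLeft_assoc, pr_braiding]

/-- The compatibility of bracket and cobracket of `H`, in terms of the coadjoint action. -/
theorem dualBracket_bracket_ev (hH : IsBraidedLieBialgebra H br cobr) (f g : K ⟶ Hd)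
    (x y : K ⟶ H) :
    (((f ⊠ₚ g) ≫ dualBracket H Hd cobr) ⊠ₚ ((x ⊠ₚ y) ≫ br)) ≫ ev H Hd =
      -(((((x ⊠ₚ f) ≫ opLeftAct H Hd (dualCobracket H Hd br)) ⊠ₚ g) ≫
          dualBracket H Hd cobr) ⊠ₚ y) ≫ ev H Hd
      -(((f ⊠ₚ ((x ⊠ₚ g) ≫ opLeftAct H Hd (dualCobracket H Hd br))) ≫
          dualBracket H Hd cobr) ⊠ₚ y) ≫ ev H Hd
      +(((((y ⊠ₚ f) ≫ opLeftAct H Hd (dualCobracket H Hd br)) ⊠ₚ g) ≫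
          dualBracket H Hd cobr) ⊠ₚ x) ≫ ev H Hd
      +(((f ⊠ₚ ((y ⊠ₚ g) ≫ opLeftAct H Hd (dualCobracket H Hd br))) ≫
          dualBracket H Hd cobr) ⊠ₚ x) ≫ ev H Hd := by
  -- The action of `x` moves across the pairing leg by leg. The signs come from f([x,a]) =
  -- -f([a,x]), because `opLeftAct_ev` has `x` in the second slot.
  have key (x : K ⟶ H) (t : K ⟶ H ⊗ H) : ((f ⊠ₚ g) ⊠ₚ ((x ⊠ₚ t) ≫ adTensor H br)) ≫ ev₂ H Hd =
      -((((x ⊠ₚ f) ≫ opLeftAct H Hd (dualCobracket H Hd br)) ⊠ₚ g) ⊠ₚ t) ≫ ev₂ H Hd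
      -((f ⊠ₚ ((x ⊠ₚ g) ≫ opLeftAct H Hd (dualCobracket H Hd br))) ⊠ₚ t) ≫ ev₂ H Hd := by
    have h1 : (Hd ◁ Hd ◁ adTensor H br) ≫ (α_ Hd Hd (H ⊗ H)).inv ≫ ev₂ H Hd =
      - (monoidalIso (Hd ⊗ Hd ⊗ H ⊗ (H ⊗ H)) ((Hd ⊗ (Hd ⊗ H)) ⊗ (H ⊗ H))).hom ≫
        ((Hd ◁ (β_ Hd H).hom ≫ (α_ _ _ _).inv ≫ (β_ Hd H).hom ▷ Hd ≫
          opLeftAct H Hd (dualCobracket H Hd br) ▷ Hd) +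
        (Hd ◁ (β_ Hd H).hom ≫ Hd ◁ opLeftAct H Hd (dualCobracket H Hd br))) ▷ (H ⊗ H) ≫
          ev₂ H Hd := by
      apply tensor_hom_ext₅
      intro K _ _ f g x a b
      have e : (f ⊠ₚ (g ⊠ₚ (x ⊠ₚ (a ⊠ₚ b)))) ≫ (monoidalIso (Hd ⊗ Hd ⊗ H ⊗ (H ⊗ H))
        ((Hd ⊗ (Hd ⊗ H)) ⊗ (H ⊗ H))).hom = (f ⊠ₚ (g ⊠ₚ x)) ⊠ₚ (a ⊠ₚ b) := by simp
      rw [Preadditive.comp_neg, reassoc_of% e]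
      simp only [pr_whiskerRight_assoc, pr_whiskerLeft_assoc, adTensor_eval, pr_add,
        Preadditive.comp_add, pr_associator_inv_assoc, Preadditive.add_comp, pairTensor_eval,
        add_pr, pr_braiding, pr_whiskerRight, pr_whiskerLeft, opLeftAct_ev]
      rw [bracket_antisymm hH.lieAlgebra.antisymm a x, bracket_antisymm hH.lieAlgebra.antisymm b x]
      simp only [pr_neg, Preadditive.neg_comp]
      ring
    have h2 := (f ⊠ₚ (g ⊠ₚ (x ⊠ₚ t))) ≫= h1
    have e : (f ⊠ₚ (g ⊠ₚ (x ⊠ₚ t))) ≫ (monoidalIso (Hd ⊗ Hd ⊗ H ⊗ (H ⊗ H))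
        ((Hd ⊗ (Hd ⊗ H)) ⊗ (H ⊗ H))).hom = (f ⊠ₚ (g ⊠ₚ x)) ⊠ₚ t := by simp
    rw [Preadditive.comp_neg, reassoc_of% e] at h2
    simp only [pr_whiskerRight_assoc, pr_whiskerLeft_assoc,
        Preadditive.comp_add, pr_associator_inv_assoc, Preadditive.add_comp,
        add_pr, pr_braiding, pr_whiskerRight, pr_whiskerLeft] at h2
    rw [h2]
    abel
  rw [dualBracket_ev, Category.assoc, hH.compat, Preadditive.sub_comp, Preadditive.comp_sub,
    Category.id_comp, pr_braiding_assoc, pr_whiskerLeft_assoc, pr_whiskerLeft_assoc, pr_sub,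
    Preadditive.sub_comp, key, key]
  simp only [dualBracket_ev]
  abel

/-- The bracket of `H*` and the cobracket of `H` correspond to each other under
coevaluation: `∑ (e_i ⊗ e_j) ⊗ [eⁱ, eʲ] = ∑ δ (e_i) ⊗ eⁱ`. -/
theorem coev_dualBracket :
    (((1 : K ⟶ 𝟙_ C) ≫ coev H Hd) ⊠ₚ ((1 : K ⟶ 𝟙_ C) ≫ coev H Hd)) ≫ tensorμ H Hd H Hd ≫
      (H ⊗ H) ◁ dualBracket H Hd cobr = (1 : K ⟶ 𝟙_ C) ≫ coev H Hd ≫ cobr ▷ Hd := by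
  have h1 : ((H ⊗ H) ◁ dualBracket H Hd cobr) ▷ H ≫ contract (H ⊗ H) (ev H Hd) =
      ((H ⊗ H) ⊗ (Hd ⊗ Hd)) ◁ cobr ≫ contract (H ⊗ H) (ev₂ H Hd) := by
    apply tensor_hom_ext₂₁
    intro K _ _ U F x
    rw [pr_whiskerRight_assoc, pr_whiskerLeft_assoc, pr_whiskerLeft, pr_contract, pr_contract,
      dualBracket_ev]
  have h2 : tensorμ H Hd H Hd ▷ (H ⊗ H) ≫ contract (H ⊗ H) (ev₂ H Hd) =
      tensorμ (H ⊗ Hd) (H ⊗ Hd) H H ≫ (contract H (ev H Hd) ⊗ₘ contract H (ev H Hd)) := by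
    rw [← cancel_epi (monoidalIso (H ⊗ Hd ⊗ H ⊗ Hd ⊗ H ⊗ H)
      (((H ⊗ Hd) ⊗ (H ⊗ Hd)) ⊗ (H ⊗ H))).hom]
    apply tensor_hom_ext₆
    intro K _ _ x f y g z w
    have e : (x ⊠ₚ (f ⊠ₚ (y ⊠ₚ (g ⊠ₚ (z ⊠ₚ w))))) ≫ (monoidalIso (H ⊗ Hd ⊗ H ⊗ Hd ⊗ H ⊗ H)
      (((H ⊗ Hd) ⊗ (H ⊗ Hd)) ⊗ (H ⊗ H))).hom = ((x ⊠ₚ f) ⊠ₚ (y ⊠ₚ g)) ⊠ₚ (z ⊠ₚ w) := by simp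
    rw [reassoc_of% e, reassoc_of% e, pr_whiskerRight_assoc, pr_tensorμ, pr_contract,
      pr_tensorμ_assoc, pr_tensorHom, pr_contract, pr_contract, pairTensor_eval, smul_pr, pr_smul,
      mul_smul]
  have h3 : (cobr ▷ Hd) ▷ H ≫ contract (H ⊗ H) (ev H Hd) = contract H (ev H Hd) ≫ cobr := by
    apply tensor_hom_ext₂₁
    intro K _ _ x f y
    rw [pr_whiskerRight_assoc, pr_whiskerRight, pr_contract, pr_contract_assoc, smul_comp_eq]
  have key : (λ_ (𝟙_ C)).inv ≫ (coev H Hd ⊗ₘ coev H Hd) ≫ tensorμ H Hd H Hd ≫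
      (H ⊗ H) ◁ dualBracket H Hd cobr = coev H Hd ≫ cobr ▷ Hd := by
    -- Both sides are contracted with an element `x` of `H`. Straightening the coevaluations yields
    -- δ(x) on each side.
    apply nondegenerate_evaluation H Hd
    rw [← cancel_epi (λ_ H).inv]
    apply hom_ext_elements
    intro K _ _ x
    rw [comp_leftUnitor_inv_eq_assoc, comp_leftUnitor_inv_eq_assoc, pr_whiskerRight_assoc,
      comp_leftUnitor_inv_eq_assoc, pr_tensorHom_assoc, ← Category.assoc, ← pr_whiskerRight,
      Category.assoc, h1, pr_whiskerLeft_assoc, ← pr_whiskerRight, Category.assoc, h2,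
      one_coev_coev_contract, comp_whiskerRight, Category.assoc, h3, pr_whiskerRight_assoc,
      ← Category.assoc, one_coev_contract]
  have := (1 : K ⟶ 𝟙_ C) ≫= key
  rwa [comp_leftUnitor_inv_eq_assoc, pr_tensorHom_assoc] at this

end Dual

/-! ### The invariant form on H* ⊕ H and the double of part (i). -/

section Form

variable {C : Type u} [Category.{v} C] [Preadditive C] [MonoidalCategory C]
  [MonoidalPreadditive C] [BraidedCategory C] [HasBinaryBiproducts C]
  (H Hd : C) [ExactPairing H Hd]

/-- The symmetric bilinear form on `H* ⊕ H` given by evaluation. -/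
noncomputable def doubleForm : (Hd ⊞ H) ⊗ (Hd ⊞ H) ⟶ 𝟙_ C :=
  (biprod.fst ⊗ₘ biprod.snd) ≫ ev H Hd + (biprod.snd ⊗ₘ biprod.fst) ≫ (β_ H Hd).hom ≫ ev H Hd

variable {K : C} [ComonObj K] [IsCommComonObj K]

theorem doubleForm_eval (X Y : K ⟶ Hd ⊞ H) : (X ⊠ₚ Y) ≫ doubleForm H Hd =
    ((X ≫ biprod.fst) ⊠ₚ (Y ≫ biprod.snd)) ≫ ev H Hd +
      ((Y ≫ biprod.fst) ⊠ₚ (X ≫ biprod.snd)) ≫ ev H Hd := by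
  simp [doubleForm]

/-- Pairing with the summand `H` sees only the `Hd` component, and pairing with `Hd` sees only the
`H` component. This reduces the claim to evaluation and to its braided version. -/
theorem nondegenerate_doubleForm : Nondegenerate (doubleForm H Hd) := by
  intro Z W m m' h
  have hl {A B P : C} (a : A ⟶ B) (p : B ⊗ P ⟶ 𝟙_ C) :
      (W ◁ a) ▷ P ≫ contract W p = contract W (a ▷ P ≫ p) := by
    simp [contract]
  have hr {A B P : C} (a : A ⟶ B) (p : P ⊗ B ⟶ 𝟙_ C) :
      (W ⊗ P) ◁ a ≫ contract W p = contract W (P ◁ a ≫ p) := by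
    simp [contract]
  have h1 : (biprod.fst : Hd ⊞ H ⟶ Hd) ▷ H ≫ ev H Hd =
      (Hd ⊞ H) ◁ (biprod.inr : H ⟶ Hd ⊞ H) ≫ doubleForm H Hd := by
    simp only [doubleForm, Preadditive.comp_add, whiskerLeft_comp_tensorHom_assoc, biprod.inr_snd,
      biprod.inr_fst, tensorHom_id, MonoidalPreadditive.tensor_zero, zero_comp, add_zero]
  have h2 : (biprod.snd : Hd ⊞ H ⟶ H) ▷ Hd ≫ (β_ H Hd).hom ≫ ev H Hd =
      (Hd ⊞ H) ◁ (biprod.inl : Hd ⟶ Hd ⊞ H) ≫ doubleForm H Hd := by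
    simp only [doubleForm, Preadditive.comp_add, whiskerLeft_comp_tensorHom_assoc, biprod.inl_snd,
      biprod.inl_fst, tensorHom_id, MonoidalPreadditive.tensor_zero, zero_comp, zero_add]
  apply whiskerLeft_biprod_hom_ext
  · apply nondegenerate_evaluation H Hd
    rw [comp_whiskerRight, comp_whiskerRight, Category.assoc, Category.assoc, hl, h1, ← hr,
      ← whisker_exchange_assoc, ← whisker_exchange_assoc, h]
  · apply nondegenerate_braiding_evaluation H Hd
    rw [comp_whiskerRight, comp_whiskerRight, Category.assoc, Category.assoc, hl, h2, ← hr,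
      ← whisker_exchange_assoc, ← whisker_exchange_assoc, h]

variable {H} [SymPair H H] [SymPair H Hd] [SymPair Hd H] [SymPair Hd Hd]
variable {br : H ⊗ H ⟶ H} {cobr : H ⟶ H ⊗ H}

theorem opDoubleBracket_fst (X Y : K ⟶ Hd ⊞ H) :
    ((X ⊠ₚ Y) ≫ opDoubleBracket H Hd br cobr) ≫ biprod.fst =
      -(((X ≫ biprod.fst) ⊠ₚ (Y ≫ biprod.fst)) ≫ dualBracket H Hd cobr) +
      ((X ≫ biprod.snd) ⊠ₚ (Y ≫ biprod.fst)) ≫ opLeftAct H Hd (dualCobracket H Hd br) -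
      ((Y ≫ biprod.snd) ⊠ₚ (X ≫ biprod.fst)) ≫ opLeftAct H Hd (dualCobracket H Hd br) := by
  simp [opDoubleBracket, doubleBracket]

theorem opDoubleBracket_snd (X Y : K ⟶ Hd ⊞ H) :
    ((X ⊠ₚ Y) ≫ opDoubleBracket H Hd br cobr) ≫ biprod.snd =
      ((X ≫ biprod.snd) ⊠ₚ (Y ≫ biprod.snd)) ≫ br +
      ((X ≫ biprod.snd) ⊠ₚ (Y ≫ biprod.fst)) ≫ opRightAct H Hd cobr -
      ((Y ≫ biprod.snd) ⊠ₚ (X ≫ biprod.fst)) ≫ opRightAct H Hd cobr := by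
  simp [opDoubleBracket, doubleBracket]

variable (hH : IsBraidedLieBialgebra H br cobr)
include hH

theorem opDoubleBracket_antisymm :
    (𝟙 ((Hd ⊞ H) ⊗ (Hd ⊞ H)) + (β_ (Hd ⊞ H) (Hd ⊞ H)).hom) ≫ opDoubleBracket H Hd br cobr = 0 := by
  have hd := (isBraidedLieAlgebra_dual Hd cobr hH.lieCoalgebra).antisymm
  apply tensor_hom_ext₂
  intro K _ _ X Y
  rw [Preadditive.add_comp, Preadditive.comp_add, Category.id_comp, pr_braiding_assoc, comp_zero]
  apply biprod.hom_ext
  · rw [Preadditive.add_comp, opDoubleBracket_fst, opDoubleBracket_fst, zero_comp,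
      bracket_antisymm hd (Y ≫ biprod.fst)]
    abel
  · rw [Preadditive.add_comp, opDoubleBracket_snd, opDoubleBracket_snd, zero_comp,
      bracket_antisymm hH.lieAlgebra.antisymm (Y ≫ biprod.snd)]
    abel

/-- The form on the double is invariant. -/
theorem doubleForm_invariant (X Y Z : K ⟶ Hd ⊞ H) :
    (((X ⊠ₚ Y) ≫ opDoubleBracket H Hd br cobr) ⊠ₚ Z) ≫ doubleForm H Hd =
      (X ⊠ₚ ((Y ⊠ₚ Z) ≫ opDoubleBracket H Hd br cobr)) ≫ doubleForm H Hd := by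
  have hd := (isBraidedLieAlgebra_dual Hd cobr hH.lieCoalgebra).antisymm
  have ha := hH.lieAlgebra.antisymm
  simp only [doubleForm_eval, opDoubleBracket_fst, opDoubleBracket_snd]
  generalize X ≫ biprod.fst = f, X ≫ biprod.snd = x, Y ≫ biprod.fst = g, Y ≫ biprod.snd = y,
    Z ≫ biprod.fst = h, Z ≫ biprod.snd = z
  simp only [pr_add, pr_sub, add_pr, sub_pr, neg_pr, Preadditive.add_comp, Preadditive.sub_comp,
    Preadditive.neg_comp, opRightAct_ev, opLeftAct_ev]
  rw [bracket_antisymm ha z x, bracket_antisymm ha z y, bracket_antisymm hd h f,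
    bracket_antisymm hd h g]
  simp only [pr_neg, neg_pr, Preadditive.neg_comp]
  abel

/-- By nondegeneracy and invariance it suffices that the cyclic sum of B([X,Y],[Z,W]) over X, Y, Z
vanishes. Splitting each argument into its H* and H parts, terms with three parts of one kind cancel
by Jacobi in H* or H. Terms with two of each kind cancel by the compatibility in
`dualBracket_bracket_ev`. -/
theorem opDoubleBracket_jacobi :
    (𝟙 (((Hd ⊞ H) ⊗ (Hd ⊞ H)) ⊗ (Hd ⊞ H)) + braid23 (Hd ⊞ H) ≫ braid12 (Hd ⊞ H) +
      braid12 (Hd ⊞ H) ≫ braid23 (Hd ⊞ H)) ≫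
      opDoubleBracket H Hd br cobr ▷ (Hd ⊞ H) ≫ opDoubleBracket H Hd br cobr = 0 := by
  apply (nondegenerate_doubleForm H Hd).separating
  rw [← cancel_epi ((α_ ((Hd ⊞ H) ⊗ (Hd ⊞ H)) (Hd ⊞ H) (Hd ⊞ H)).inv)]
  apply tensor_hom_ext₂₂
  intro K _ _ X Y Z W
  have hinv (X Y Z W : K ⟶ Hd ⊞ H) :=
    doubleForm_invariant Hd hH ((X ⊠ₚ Y) ≫ opDoubleBracket H Hd br cobr) Z W
  rw [MonoidalPreadditive.zero_whiskerRight, zero_comp, comp_zero, comp_zero]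
  simp only [pr_associator_inv_assoc, pr_whiskerRight_assoc, Preadditive.comp_add,
    Preadditive.add_comp, Category.id_comp, braid12, braid23, Category.assoc,
    pr_associator_hom_assoc, pr_whiskerLeft_assoc, pr_braiding, add_pr, hinv]
  simp only [doubleForm_eval, opDoubleBracket_fst, opDoubleBracket_snd]
  generalize X ≫ biprod.fst = f, X ≫ biprod.snd = x, Y ≫ biprod.fst = g, Y ≫ biprod.snd = y,
    Z ≫ biprod.fst = h, Z ≫ biprod.snd = z, W ≫ biprod.fst = k, W ≫ biprod.snd = w
  simp only [pr_add, pr_sub, add_pr, sub_pr, neg_pr, Preadditive.add_comp, Preadditive.sub_comp,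
    Preadditive.neg_comp, opRightAct_ev, opLeftAct_ev, dualBracket_bracket_ev Hd cobr br hH]
  have hd := isBraidedLieAlgebra_dual Hd cobr hH.lieCoalgebra
  have hU (a b : K ⟶ Hd) (u : K ⟶ H) :
      (a ⊠ₚ ((u ⊠ₚ b) ≫ opLeftAct H Hd (dualCobracket H Hd br))) ≫ dualBracket H Hd cobr =
      -((((u ⊠ₚ b) ≫ opLeftAct H Hd (dualCobracket H Hd br)) ⊠ₚ a) ≫ dualBracket H Hd cobr) :=
    bracket_antisymm hd.antisymm _ _
  have hT₁ (a b c : K ⟶ Hd) (u : K ⟶ H) :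
      (((((a ⊠ₚ b) ≫ dualBracket H Hd cobr) ⊠ₚ c) ≫ dualBracket H Hd cobr) ⊠ₚ u) ≫ ev H Hd +
      (((((b ⊠ₚ a) ≫ dualBracket H Hd cobr) ⊠ₚ c) ≫ dualBracket H Hd cobr) ⊠ₚ u) ≫ ev H Hd = 0 := by
    rw [bracket_antisymm hd.antisymm a b]
    simp
  have hT₂ (a b c : K ⟶ Hd) (u : K ⟶ H) :
      (((((a ⊠ₚ b) ≫ dualBracket H Hd cobr) ⊠ₚ c) ≫ dualBracket H Hd cobr) ⊠ₚ u) ≫ ev H Hd +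
      (((((c ⊠ₚ a) ≫ dualBracket H Hd cobr) ⊠ₚ b) ≫ dualBracket H Hd cobr) ⊠ₚ u) ≫ ev H Hd +
      (((((b ⊠ₚ c) ≫ dualBracket H Hd cobr) ⊠ₚ a) ≫ dualBracket H Hd cobr) ⊠ₚ u) ≫ ev H Hd = 0 := by
    rw [← Preadditive.add_comp, ← Preadditive.add_comp, ← add_pr, ← add_pr,
      bracket_jacobi hd.jacobi, zero_pr, zero_comp]
  have hS₁ (a : K ⟶ Hd) (u v t : K ⟶ H) :
      (a ⊠ₚ ((((u ⊠ₚ v) ≫ br) ⊠ₚ t) ≫ br)) ≫ ev H Hd +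
      (a ⊠ₚ ((((v ⊠ₚ u) ≫ br) ⊠ₚ t) ≫ br)) ≫ ev H Hd = 0 := by
    rw [bracket_antisymm hH.lieAlgebra.antisymm u v]
    simp
  have hS₂ (a : K ⟶ Hd) (u v t : K ⟶ H) :
      (a ⊠ₚ ((((u ⊠ₚ v) ≫ br) ⊠ₚ t) ≫ br)) ≫ ev H Hd +
      (a ⊠ₚ ((((t ⊠ₚ u) ≫ br) ⊠ₚ v) ≫ br)) ≫ ev H Hd +
      (a ⊠ₚ ((((v ⊠ₚ t) ≫ br) ⊠ₚ u) ≫ br)) ≫ ev H Hd = 0 := by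
    rw [← Preadditive.add_comp, ← Preadditive.add_comp, ← pr_add, ← pr_add,
      bracket_jacobi hH.lieAlgebra.jacobi, pr_zero, zero_comp]
  -- Normal form: an acted-on functional always stands in the first slot of the dual bracket. The
  -- terms with two parts of each kind then cancel formally.
  simp only [hU, neg_pr, Preadditive.neg_comp]
  -- There is one Jacobi identity for each choice of the argument whose part is of the exceptional
  -- kind: `hT₂` in H* with a single part in H, `hS₂` in H with a single part in H*. The `hT₁` and
  -- `hS₁` terms only reorder inner brackets.
  linear_combination (exp := 1) hT₂ f g h w - hT₂ f g k z + hT₁ k f g z - hT₂ h f k y + hT₁ k h f y -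
    hT₂ g h k x + hT₁ k g h x + hS₂ k x y z - hS₂ f y z w + hS₁ f w y z - hS₂ g z x w +
    hS₁ g w z x - hS₂ h x y w + hS₁ h w x y

/-- The cobracket is the direct sum of two Lie cobrackets, so the axioms transfer along the two
inclusions by naturality of the braiding. -/
theorem opDoubleCobracket_lieCoalgebra :
    IsBraidedLieCoalgebra (Hd ⊞ H) (opDoubleCobracket H Hd br cobr) where
  symm := SymPair.braiding_braiding
  coantisymm := by
    have h1 := hH.lieCoalgebra.comp_braiding
    have h2 := (isBraidedLieCoalgebra_dual Hd br hH.lieAlgebra).comp_braiding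
    apply biprod.hom_ext' <;>
    simp [opDoubleCobracket, doubleCobracket, reassoc_of% h1, reassoc_of% h2]
  cojacobi := by
    have key {A : C} (i : A ⟶ Hd ⊞ H) (c : A ⟶ A ⊗ A) (hc : IsBraidedLieCoalgebra A c)
        (hi : i ≫ opDoubleCobracket H Hd br cobr = c ≫ (i ⊗ₘ i)) :
        i ≫ opDoubleCobracket H Hd br cobr ≫ opDoubleCobracket H Hd br cobr ▷ (Hd ⊞ H) ≫
        (𝟙 (((Hd ⊞ H) ⊗ (Hd ⊞ H)) ⊗ (Hd ⊞ H)) + braid23 (Hd ⊞ H) ≫ braid12 (Hd ⊞ H) +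
          braid12 (Hd ⊞ H) ≫ braid23 (Hd ⊞ H)) = 0 := by
      have e12 : ((i ⊗ₘ i) ⊗ₘ i) ≫ braid12 (Hd ⊞ H) = braid12 A ≫ ((i ⊗ₘ i) ⊗ₘ i) := by
        rw [braid12, braid12, tensorHom_comp_whiskerRight, BraidedCategory.braiding_naturality,
          whiskerRight_comp_tensorHom]
      have e23 : ((i ⊗ₘ i) ⊗ₘ i) ≫ braid23 (Hd ⊞ H) = braid23 A ≫ ((i ⊗ₘ i) ⊗ₘ i) := by
        simp [braid23, tensorHom_comp_whiskerLeft_assoc, whiskerLeft_comp_tensorHom_assoc]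
      have e : i ≫ opDoubleCobracket H Hd br cobr ≫ opDoubleCobracket H Hd br cobr ▷ (Hd ⊞ H) =
          c ≫ c ▷ A ≫ ((i ⊗ₘ i) ⊗ₘ i) := by
        rw [reassoc_of% hi, tensorHom_comp_whiskerRight, hi, whiskerRight_comp_tensorHom]
      rw [reassoc_of% e]
      simp only [Preadditive.comp_add, Category.comp_id, reassoc_of% e12, reassoc_of% e23, e12, e23]
      have := hc.cojacobi =≫ ((i ⊗ₘ i) ⊗ₘ i)
      simpa using this
    apply biprod.hom_ext'
    · rw [comp_zero]
      apply key _ _ (isBraidedLieCoalgebra_dual Hd br hH.lieAlgebra)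
      simp [opDoubleCobracket, doubleCobracket]
    · rw [comp_zero]
      apply key _ _ hH.lieCoalgebra
      simp [opDoubleCobracket, doubleCobracket]

/-- The form on `(H* ⊕ H) ⊗ (H* ⊕ H)` is invariant. -/
theorem adTensor_pairTensor_doubleForm (X Y Z : K ⟶ Hd ⊞ H) (t : K ⟶ (Hd ⊞ H) ⊗ (Hd ⊞ H)) :
    (((X ⊠ₚ t) ≫ adTensor _ (opDoubleBracket H Hd br cobr)) ⊠ₚ (Y ⊠ₚ Z)) ≫
      pairTensor (doubleForm H Hd) (doubleForm H Hd) =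
    -((t ⊠ₚ (((X ⊠ₚ Y) ≫ opDoubleBracket H Hd br cobr) ⊠ₚ Z)) ≫
      pairTensor (doubleForm H Hd) (doubleForm H Hd) +
    (t ⊠ₚ (Y ⊠ₚ ((X ⊠ₚ Z) ≫ opDoubleBracket H Hd br cobr))) ≫
      pairTensor (doubleForm H Hd) (doubleForm H Hd)) := by
  have inv {K : C} [ComonObj K] [IsCommComonObj K] (X a Y : K ⟶ Hd ⊞ H) :
      (((X ⊠ₚ a) ≫ opDoubleBracket H Hd br cobr) ⊠ₚ Y) ≫ doubleForm H Hd =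
        -((a ⊠ₚ ((X ⊠ₚ Y) ≫ opDoubleBracket H Hd br cobr)) ≫ doubleForm H Hd) := by
    rw [bracket_antisymm (opDoubleBracket_antisymm Hd hH), neg_pr, Preadditive.neg_comp,
      doubleForm_invariant Hd hH]
  have key : (α_ _ _ _).inv ≫
      adTensor _ (opDoubleBracket H Hd br cobr) ▷ ((Hd ⊞ H) ⊗ (Hd ⊞ H)) ≫
        pairTensor (doubleForm H Hd) (doubleForm H Hd) =
      -((α_ _ _ _).inv ≫ (β_ _ _).hom ▷ _ ≫ (α_ _ _ _).hom ≫ ((Hd ⊞ H) ⊗ (Hd ⊞ H)) ◁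
        adTensor _ (opDoubleBracket H Hd br cobr) ≫
          pairTensor (doubleForm H Hd) (doubleForm H Hd)) := by
    rw [← cancel_epi ((Hd ⊞ H) ◁ (α_ (Hd ⊞ H) (Hd ⊞ H) ((Hd ⊞ H) ⊗ (Hd ⊞ H))).inv)]
    apply tensor_hom_ext₅
    intro K _ _ X a b Y Z
    simp only [pr_whiskerLeft_assoc, pr_associator_inv, Preadditive.comp_neg,
      pr_associator_inv_assoc, pr_whiskerRight_assoc, pr_braiding, pr_associator_hom_assoc,
      adTensor_eval, add_pr, pr_add, Preadditive.add_comp, pairTensor_eval, inv]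
    ring
  have := (X ⊠ₚ (t ⊠ₚ (Y ⊠ₚ Z))) ≫= key
  simpa only [Preadditive.comp_neg, pr_associator_inv_assoc, pr_whiskerRight_assoc, pr_braiding,
    pr_associator_hom_assoc, pr_whiskerLeft_assoc, adTensor_eval, pr_add, Preadditive.add_comp]
    using this

/-- Pair both sides with Y ⊗ Z. The left side gives f([y,z]) + [g,h](x), for f, g, h the H* parts
and x, y, z the H parts of X, Y, Z, with the bracket of H*. On the right, R pairs with Y ⊗ Z to
h(y), and invariance moves ad(X) onto Y and Z. -/
theorem opDouble_isCoboundary : IsCoboundary (Hd ⊞ H) (opDoubleBracket H Hd br cobr)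
    (opDoubleCobracket H Hd br cobr) (opDoubleR H Hd) := by
  apply (nondegenerate_doubleForm H Hd).separating.tensor (nondegenerate_doubleForm H Hd)
  apply tensor_hom_ext₃
  intro K _ _ X Y Z
  have hl (t : K ⟶ Hd ⊗ Hd) : ((t ≫ (biprod.inl ⊗ₘ biprod.inl)) ⊠ₚ (Y ⊠ₚ Z)) ≫
      pairTensor (doubleForm H Hd) (doubleForm H Hd) =
      (t ⊠ₚ ((Y ≫ biprod.snd) ⊠ₚ (Z ≫ biprod.snd))) ≫ ev₂ H Hd := by
    have key : (biprod.inl ⊗ₘ biprod.inl) ▷ ((Hd ⊞ H) ⊗ (Hd ⊞ H)) ≫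
        pairTensor (doubleForm H Hd) (doubleForm H Hd) =
        (Hd ⊗ Hd) ◁ (biprod.snd ⊗ₘ biprod.snd) ≫ ev₂ H Hd := by
      apply tensor_hom_ext₂₂
      intro K _ _ f g Y Z
      rw [pr_whiskerRight_assoc, pr_tensorHom, pr_whiskerLeft_assoc, pr_tensorHom]
      simp [doubleForm_eval]
    have := (t ⊠ₚ (Y ⊠ₚ Z)) ≫= key
    rwa [pr_whiskerRight_assoc, pr_whiskerLeft_assoc, pr_tensorHom] at this
  have hr (t : K ⟶ H ⊗ H) : ((t ≫ (biprod.inr ⊗ₘ biprod.inr)) ⊠ₚ (Y ⊠ₚ Z)) ≫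
      pairTensor (doubleForm H Hd) (doubleForm H Hd) =
      (((Y ≫ biprod.fst) ⊠ₚ (Z ≫ biprod.fst)) ⊠ₚ t) ≫ ev₂ H Hd := by
    have key : (biprod.inr ⊗ₘ biprod.inr) ▷ ((Hd ⊞ H) ⊗ (Hd ⊞ H)) ≫
        pairTensor (doubleForm H Hd) (doubleForm H Hd) =
        (H ⊗ H) ◁ (biprod.fst ⊗ₘ biprod.fst) ≫ (β_ (H ⊗ H) (Hd ⊗ Hd)).hom ≫ ev₂ H Hd := by
      apply tensor_hom_ext₂₂
      intro K _ _ f g Y Z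
      rw [pr_whiskerRight_assoc, pr_tensorHom, pr_whiskerLeft_assoc, pr_tensorHom,
        pr_braiding_assoc]
      simp [doubleForm_eval]
    have := (t ⊠ₚ (Y ⊠ₚ Z)) ≫= key
    rwa [pr_whiskerRight_assoc, pr_whiskerLeft_assoc, pr_tensorHom, pr_braiding_assoc] at this
  have hR (Y Z : K ⟶ Hd ⊞ H) : (((1 : K ⟶ 𝟙_ C) ≫ opDoubleR H Hd) ⊠ₚ (Y ⊠ₚ Z)) ≫
      pairTensor (doubleForm H Hd) (doubleForm H Hd) =
      ((Z ≫ biprod.fst) ⊠ₚ (Y ≫ biprod.snd)) ≫ ev H Hd := by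
    have key : ((β_ H Hd).hom ≫ (biprod.inl ⊗ₘ biprod.inr)) ▷ ((Hd ⊞ H) ⊗ (Hd ⊞ H)) ≫
        pairTensor (doubleForm H Hd) (doubleForm H Hd) =
        (α_ _ _ _).inv ≫ ((H ⊗ Hd) ◁ biprod.snd ≫ contract H (ev H Hd)) ▷ (Hd ⊞ H) ≫
          H ◁ biprod.fst ≫ (β_ H Hd).hom ≫ ev H Hd := by
      apply tensor_hom_ext₂₂
      intro K _ _ x f Y Z
      rw [pr_whiskerRight_assoc, pr_braiding_assoc, pr_tensorHom, pairTensor_eval,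
        pr_associator_inv_assoc, pr_whiskerRight_assoc, pr_whiskerLeft_assoc,
        pr_whiskerLeft_assoc, pr_contract, pr_braiding_assoc]
      simp [doubleForm_eval]
    have := (((1 : K ⟶ 𝟙_ C) ≫ coev H Hd) ⊠ₚ (Y ⊠ₚ Z)) ≫= key
    rw [pr_whiskerRight_assoc, Category.assoc, pr_associator_inv_assoc, pr_whiskerRight_assoc,
      pr_whiskerLeft_assoc, pr_whiskerLeft_assoc, one_coev_contract, pr_braiding_assoc] at this
    exact this
  have hd := (isBraidedLieAlgebra_dual Hd cobr hH.lieCoalgebra).antisymm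
  rw [pr_whiskerRight_assoc, pr_whiskerRight_assoc, comp_rightUnitor_inv_eq_assoc,
    pr_whiskerLeft_assoc, adTensor_pairTensor_doubleForm Hd hH, hR, hR]
  have e : X ≫ opDoubleCobracket H Hd br cobr =
      ((X ≫ biprod.fst) ≫ dualCobracket H Hd br) ≫ (biprod.inl ⊗ₘ biprod.inl) +
      ((X ≫ biprod.snd) ≫ cobr) ≫ (biprod.inr ⊗ₘ biprod.inr) := by
    simp [opDoubleCobracket, doubleCobracket]
  rw [e, add_pr, Preadditive.add_comp, hl, hr, dualCobracket_ev, ← dualBracket_ev,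
    opDoubleBracket_fst, opDoubleBracket_snd]
  simp only [pr_add, pr_sub, add_pr, sub_pr, neg_pr, Preadditive.add_comp, Preadditive.sub_comp,
    Preadditive.neg_comp, opRightAct_ev, opLeftAct_ev]
  rw [bracket_antisymm hH.lieAlgebra.antisymm (Y ≫ biprod.snd) (X ≫ biprod.snd),
    bracket_antisymm hd (Z ≫ biprod.fst) (Y ≫ biprod.fst),
    bracket_antisymm hd (Z ≫ biprod.fst) (X ≫ biprod.fst)]
  simp only [pr_neg, neg_pr, Preadditive.neg_comp]
  abel

/-- Write R = ∑ eⁱ ⊗ e_i. The last two terms sum to (id ⊗ δ)R = ∑ eⁱ ⊗ δ(e_i). The first term is -∑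
[eⁱ, eʲ] ⊗ e_i ⊗ e_j, the sign being that of the opposite bracket, and `coev_dualBracket` shows that
the two cancel. -/
theorem opDouble_isCYBE : IsCYBE (Hd ⊞ H) (opDoubleBracket H Hd br cobr) (opDoubleR H Hd) := by
  rw [isCYBE_iff]
  intro K _ _
  have h1 : (((β_ H Hd).hom ≫ (biprod.inl ⊗ₘ biprod.inr)) ⊗ₘ
        ((β_ H Hd).hom ≫ (biprod.inl ⊗ₘ biprod.inr))) ≫
        cybe₁ (Hd ⊞ H) (opDoubleBracket H Hd br cobr) =
      -(tensorμ H Hd H Hd ≫ (H ⊗ H) ◁ dualBracket H Hd cobr ≫ (β_ (H ⊗ H) Hd).hom ≫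
        (biprod.inl ⊗ₘ (biprod.inr ⊗ₘ biprod.inr))) := by
    have e {K : C} [ComonObj K] [IsCommComonObj K] (f g : K ⟶ Hd) :
        ((f ≫ biprod.inl) ⊠ₚ (g ≫ biprod.inl)) ≫ opDoubleBracket H Hd br cobr =
        -(((f ⊠ₚ g) ≫ dualBracket H Hd cobr) ≫ biprod.inl) := by
      simp [opDoubleBracket, doubleBracket]
    apply tensor_hom_ext₂₂
    intro K _ _ x f y g
    rw [Preadditive.comp_neg, pr_tensorHom_assoc, pr_braiding_assoc, pr_braiding_assoc,
      pr_tensorHom, pr_tensorHom, cybe₁_eval, e, pr_tensorμ_assoc, pr_whiskerLeft_assoc,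
      pr_braiding_assoc, pr_tensorHom, pr_tensorHom, neg_pr]
  have h2 : (β_ H Hd).hom ≫ (biprod.inl ⊗ₘ biprod.inr) ≫
        (Hd ⊞ H) ◁ opDoubleCobracket H Hd br cobr =
      cobr ▷ Hd ≫ (β_ (H ⊗ H) Hd).hom ≫ (biprod.inl ⊗ₘ (biprod.inr ⊗ₘ biprod.inr)) := by
    have e : biprod.inr ≫ opDoubleCobracket H Hd br cobr = cobr ≫ (biprod.inr ⊗ₘ biprod.inr) := by
      simp [opDoubleCobracket, doubleCobracket]
    rw [tensorHom_comp_whiskerLeft, e, BraidedCategory.braiding_naturality_left_assoc,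
      whiskerLeft_comp_tensorHom]
  rw [add_assoc, Preadditive.comp_add, (opDouble_isCoboundary Hd hH).cybe₂_add_cybe₃]
  have h3 : ((1 : K ⟶ 𝟙_ C) ≫ opDoubleR H Hd) = ((1 : K ⟶ 𝟙_ C) ≫ coev H Hd) ≫
      ((β_ H Hd).hom ≫ (biprod.inl ⊗ₘ biprod.inr)) := by
    simp [opDoubleR]
  rw [h3, ← pr_tensorHom, Category.assoc, h1, Category.assoc, Category.assoc, Category.assoc, h2,
    Preadditive.comp_neg, reassoc_of% (coev_dualBracket (K := K) Hd cobr), neg_add_cancel]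

theorem opDouble_isQuasitriangular : IsQuasitriangular (Hd ⊞ H) (opDoubleBracket H Hd br cobr)
    (opDoubleCobracket H Hd br cobr) (opDoubleR H Hd) := by
  have hL : IsBraidedLieAlgebra (Hd ⊞ H) (opDoubleBracket H Hd br cobr) :=
    { symm := SymPair.braiding_braiding
      antisymm := opDoubleBracket_antisymm Hd hH
      jacobi := opDoubleBracket_jacobi Hd hH }
  have hR := opDouble_isCoboundary Hd hH
  exact
  { lieBialgebra :=
    { lieAlgebra := hL
      lieCoalgebra := opDoubleCobracket_lieCoalgebra Hd hH
      compat := hR.compat hL }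
    coboundary := hR
    cybe := opDouble_isCYBE Hd hH }

/-! ### Reduction of part (ii) to part (i) for the negated cobracket. -/

omit hH

theorem quantumDoubleR_eq : quantumDoubleR H Hd = opDoubleR H Hd ≫ (β_ (Hd ⊞ H) (Hd ⊞ H)).hom := by
  simp [quantumDoubleR, opDoubleR, BraidedCategory.braiding_naturality,
    SymPair.braiding_braiding_assoc]

theorem quantumDoubleCobracket_eq :
    quantumDoubleCobracket H Hd br cobr = -opDoubleCobracket H Hd br (-cobr) := by
  simp [quantumDoubleCobracket, opDoubleCobracket, doubleCobracket, add_comm]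

theorem dualBracket_neg : dualBracket H Hd (-cobr) = -dualBracket H Hd cobr := by
  simp [dualBracket, monoidalComp]

/-- The two actions evaluate `f` on different legs of the cobracket; antisymmetry exchanges the legs
at the cost of the sign. `copLeftAct_neg` holds for the same reason. -/
theorem opRightAct_neg (h : IsBraidedLieCoalgebra H cobr) :
    opRightAct H Hd (-cobr) = copRightAct H Hd cobr := by
  have h1 : copRightAct H Hd cobr =
      cobr ▷ Hd ≫ (α_ _ _ _).hom ≫ H ◁ ((β_ H Hd).hom) ≫ (α_ _ _ _).inv ≫
        ((β_ H Hd).hom ≫ ev H Hd) ▷ H ≫ (λ_ H).hom := by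
    simp [copRightAct, monoidalComp]
  have h2 : (α_ _ _ _).hom ≫ H ◁ ((β_ H Hd).hom) ≫ (α_ _ _ _).inv ≫
        ((β_ H Hd).hom ≫ ev H Hd) ▷ H ≫ (λ_ H).hom =
      (β_ H H).hom ▷ Hd ≫ (α_ _ _ _).hom ≫ H ◁ ((β_ H Hd).hom ≫ ev H Hd) ≫ (ρ_ H).hom := by
    apply tensor_hom_ext₂₁
    intro K _ _ x y f
    simp
  rw [h1, h2, ← comp_whiskerRight_assoc, h.comp_braiding]
  simp [opRightAct, monoidalComp]

theorem copLeftAct_neg {cobrA : Hd ⟶ Hd ⊗ Hd} (h : IsBraidedLieCoalgebra Hd cobrA) :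
    copLeftAct H Hd (-cobrA) = opLeftAct H Hd cobrA := by
  have h1 : opLeftAct H Hd cobrA = H ◁ cobrA ≫ (α_ _ _ _).inv ≫ (β_ H Hd).hom ▷ Hd ≫
      (α_ _ _ _).hom ≫ Hd ◁ ((β_ H Hd).hom ≫ ev H Hd) ≫ (ρ_ Hd).hom := by
    simp [opLeftAct, monoidalComp]
  have h2 : (α_ _ _ _).inv ≫ (β_ H Hd).hom ▷ Hd ≫
      (α_ _ _ _).hom ≫ Hd ◁ ((β_ H Hd).hom ≫ ev H Hd) ≫ (ρ_ Hd).hom =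
      H ◁ (β_ Hd Hd).hom ≫ (α_ _ _ _).inv ≫ ((β_ H Hd).hom ≫ ev H Hd) ▷ Hd ≫ (λ_ Hd).hom := by
    apply tensor_hom_ext₃
    intro K _ _ x f g
    simp
  rw [h1, h2, ← MonoidalCategory.whiskerLeft_comp_assoc, h.comp_braiding]
  simp [copLeftAct, monoidalComp]

theorem quantumDoubleBracket_eq (hH : IsBraidedLieBialgebra H br cobr) :
    quantumDoubleBracket H Hd br cobr = opDoubleBracket H Hd br (-cobr) := by
  rw [quantumDoubleBracket, opDoubleBracket, dualBracket_neg, neg_neg, opRightAct_neg Hd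
    hH.lieCoalgebra, copLeftAct_neg Hd (isBraidedLieCoalgebra_dual Hd br hH.lieAlgebra)]

end Form

end BraidedLie

theorem theorem2p1 {C : Type u} [Category.{v} C] [Preadditive C] [HasZeroObject C] [HasBinaryBiproducts C]
    [MonoidalCategory C] [MonoidalPreadditive C] [BraidedCategory C]
    (H Hd : C) [ExactPairing H Hd] (br : H ⊗ H ⟶ H) (cobr : H ⟶ H ⊗ H)
    (hH : BraidedLie.IsBraidedLieBialgebra H br cobr) :
    BraidedLie.IsQuasitriangular (Hd ⊞ H)
      (BraidedLie.opDoubleBracket H Hd br cobr)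
      (BraidedLie.opDoubleCobracket H Hd br cobr)
      (BraidedLie.opDoubleR H Hd) ∧
    BraidedLie.IsQuasitriangular (Hd ⊞ H)
      (BraidedLie.quantumDoubleBracket H Hd br cobr)
      (BraidedLie.quantumDoubleCobracket H Hd br cobr)
      (BraidedLie.quantumDoubleR H Hd) := by
  have := hH.lieAlgebra.symm.symPair
  -- Symmetry on `H` alone is assumed; dualizing one factor at a time extends it to all pairs from
  -- `H` and `Hd`.
  have : BraidedLie.SymPair Hd H := BraidedLie.SymPair.dual_left H H Hd
  have : BraidedLie.SymPair H Hd := BraidedLie.SymPair.swap Hd H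
  have : BraidedLie.SymPair Hd Hd := BraidedLie.SymPair.dual_left Hd H Hd
  refine ⟨BraidedLie.opDouble_isQuasitriangular Hd hH, ?_⟩
  rw [BraidedLie.quantumDoubleBracket_eq Hd hH, BraidedLie.quantumDoubleCobracket_eq,
    BraidedLie.quantumDoubleR_eq]
  exact (BraidedLie.opDouble_isQuasitriangular Hd hH.neg).flip
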